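/- Let $M$ be an oriented Riemannian $3$-manifold (smooth, Hausdorff, second countable) with a smooth metric-compatible connection $\nabla$ on $TM$, with torsion $T(X,Y)=\nabla_XY-\nabla_YX-[X,Y]$, curvature $R(X,Y)Z=\nabla_X\nabla_YZ-\nabla_Y\nabla_XZ-\nabla_{[X,Y]}Z$ and Ricci curvature $\mathrm{Ric}(X,Y)=\operatorname{tr}(Z\mapsto R(Z,X)Y)$; the torsion need not vanish. Let $S$ be an oriented smooth surface embedded in $M$, with smooth unit normal field $N$ such that a tangent frame $(E_1,E_2)$ of $S$ is oriented iff the frame $(N,E_1,E_2)$ of $M$ is oriented. Let $\mathrm{II}(X,Y)=\langle N,\nabla_X\tilde Y\rangle$ for tangent fields $X,Y$ of $S$ and any smooth extension $\tilde Y$ of $Y$ (in general $\mathrm{II}$ is not symmetric). Let $H=\operatorname{tr}W$ with $\mathrm{II}(X,Y)=\langle W(X),Y\rangle$, let $\tau(X,Y)=\langle N,T(X,Y)\rangle$ for $X,Y$ tangent to $S$, let $\star$ be the Hodge star of $S$, and put $\boldsymbol H=H+\boldsymbol i\,{\star}\tau\colon S\to\mathbb C$. A local complex chart $z=x+\boldsymbol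 iy$ on $S$ is a diffeomorphism from an open subset of $S$ onto an open subset of $\mathbb C$ that is conformal for the induced metric and orientation-preserving. A function on $S$ is holomorphic if it is holomorphic in every local complex chart. The Hopf differential $\varphi=\mathrm{II}\left(\frac{\partial}{\partial z},\frac{\partial}{\partial z}\right)\mathrm dz^2$ (with $\mathrm{II}$ extended $\mathbb C$-bilinearly) is a holomorphic quadratic differential if its coefficient in every local complex chart $z$ is holomorphic. 1. Suppose that at every $x\in M$ there are real numbers $r$ and $t$ such that $\mathrm{Ric}(u,v)=r\langle u,v\rangle$ and $T(u,v)=t\,u\times v$ for all $u,v\in T_xM$. Then, for every oriented smooth surface $S$ embedded in $M$, $\boldsymbol H$ is holomorphic on $S$ if and only if the Hopf differential $\varphi$ is a holomorphic quadratic differential on $S$. 2. (Hopf's classical case.) Suppose that $\nabla$ is torsion-free, i.e. the Levi-Civita connection, and that $M$ has constant sectional curvature. Then, for every oriented smooth surface $S$ embedded in $M$, $\boldsymbol H=H$ is real-valued, and $\varphi$ is a holomorphic quadratic differential on $S$ if and only if the mean curvature $H$ is locally constant on the domain of every local complex chart of $S$. (Local complex charts, that is, oriented isothermal coordinates, exist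 around every point, so this says that $H$ is locally constant on $S$, hence constant if $S$ is connected.) -/

import Mathlib

open Manifold Bundle Module
open scoped ContDiff Topology

noncomputable section

/-! ### Linear algebra of an oriented Euclidean 3-space -/

/-- The cross product of an oriented three-dimensional inner product space: `u × v` is the vector
representing the functional `w ↦ vol (u, v, w)`. -/
def crossProd {V : Type*} [NormedAddCommGroup V] [InnerProductSpace ℝ V]
    [Fact (finrank ℝ V = 3)] (o : Orientation ℝ V (Fin 3)) (u v : V) : V :=
  have : FiniteDimensional ℝ V := .of_fact_finrank_eq_succ 2
  (InnerProductSpace.toDual ℝ V).symm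
    (LinearMap.toContinuousLinearMap (o.volumeForm.toMultilinearMap.toLinearMap ![u, v, 0] 2))

theorem inner_crossProd {V : Type*} [NormedAddCommGroup V] [InnerProductSpace ℝ V]
    [Fact (finrank ℝ V = 3)] (o : Orientation ℝ V (Fin 3)) (u v w : V) :
    inner ℝ (crossProd o u v) w = o.volumeForm ![u, v, w] := by
  have : FiniteDimensional ℝ V := .of_fact_finrank_eq_succ 2
  unfold crossProd
  rw [InnerProductSpace.toDual_symm_apply]
  simp only [LinearMap.coe_toContinuousLinearMap', MultilinearMap.toLinearMap_apply,
    AlternatingMap.coe_multilinearMap]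
  congr 1
  ext i
  fin_cases i <;> simp [Function.update]

/-! ### The ambient 3-manifold -/

/-- The model space of 3-manifolds. -/
abbrev E3 : Type := EuclideanSpace ℝ (Fin 3)

/-- The model space of surfaces. -/
abbrev E2 : Type := EuclideanSpace ℝ (Fin 2)

instance factFinrankTangent {M : Type*} [TopologicalSpace M] [ChartedSpace E3 M] (x : M) :
    Fact (finrank ℝ (TangentSpace (𝓡 3) x) = 3) :=
  ⟨by
    change finrank ℝ (EuclideanSpace ℝ (Fin 3)) = 3
    simp⟩

instance finiteDimensionalTangent {M : Type*} [TopologicalSpace M] [ChartedSpace E3 M] (x : M) :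
    FiniteDimensional ℝ (TangentSpace (𝓡 3) x) := by
  change FiniteDimensional ℝ (EuclideanSpace ℝ (Fin 3))
  infer_instance

instance riemannianBundleOne {M : Type*} [TopologicalSpace M] [ChartedSpace E3 M]
    [IsManifold (𝓡 3) ∞ M] [RiemannianBundle (fun x : M => TangentSpace (𝓡 3) x)]
    [IsContMDiffRiemannianBundle (𝓡 3) ∞ E3 (fun x : M => TangentSpace (𝓡 3) x)] :
    IsContMDiffRiemannianBundle (𝓡 3) 1 E3 (fun x : M => TangentSpace (𝓡 3) x) :=
  IsContMDiffRiemannianBundle.of_le (n := ∞) (by simp)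

section Ambient

variable {M : Type*} [TopologicalSpace M] [ChartedSpace E3 M] [IsManifold (𝓡 3) ∞ M]
  [RiemannianBundle (fun x : M => TangentSpace (𝓡 3) x)]

variable (M) in
/-- An orientation of the manifold `M`: an orientation of every tangent space such that a frame of
smooth vector fields which is positively oriented at a point is so at all nearby points. -/
structure ManifoldOrientation where
  at_ : ∀ x : M, Orientation ℝ (TangentSpace (𝓡 3) x) (Fin 3)
  locally_constant : ∀ (x₀ : M) (X : Fin 3 → Π x : M, TangentSpace (𝓡 3) x),
    (∀ i, ContMDiffAt (𝓡 3) (𝓡 3).tangent ∞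
      (fun x => (⟨x, X i x⟩ : TangentBundle (𝓡 3) M)) x₀) →
    0 < (at_ x₀).volumeForm (fun i => X i x₀) →
    ∀ᶠ x in 𝓝 x₀, 0 < (at_ x).volumeForm (fun i => X i x)

/-- The curvature `R(X,Y)Z = ∇_X ∇_Y Z - ∇_Y ∇_X Z - ∇_[X,Y] Z` on vector fields
(`cov Z x (X x)` is `∇_X Z` at `x`). -/
def curvatureField (cov : CovariantDerivative (𝓡 3) E3 (fun x : M => TangentSpace (𝓡 3) x))
    (X Y Z : Π x : M, TangentSpace (𝓡 3) x) (x : M) : TangentSpace (𝓡 3) x :=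
  cov (fun y => cov Z y (Y y)) x (X x) - cov (fun y => cov Z y (X y)) x (Y x)
    - cov Z x (VectorField.mlieBracket (𝓡 3) X Y x)

/-- The curvature tensor `R(u,v)w` at a point, computed with extensions of `u`, `v`, `w` to vector
fields that are smooth near that point. -/
def curvatureAt (cov : CovariantDerivative (𝓡 3) E3 (fun x : M => TangentSpace (𝓡 3) x))
    (x : M) (u v w : TangentSpace (𝓡 3) x) : TangentSpace (𝓡 3) x :=
  curvatureField cov (FiberBundle.extend E3 u) (FiberBundle.extend E3 v)
    (FiberBundle.extend E3 w) x

/-- The Ricci curvature `Ric(u,v) = tr (w ↦ R(w,u)v)`, the trace being computed in an orthonormal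
basis. -/
def ricci (cov : CovariantDerivative (𝓡 3) E3 (fun x : M => TangentSpace (𝓡 3) x))
    (x : M) (u v : TangentSpace (𝓡 3) x) : ℝ :=
  ∑ i, inner ℝ (curvatureAt cov x (stdOrthonormalBasis ℝ (TangentSpace (𝓡 3) x) i) u v)
    (stdOrthonormalBasis ℝ (TangentSpace (𝓡 3) x) i)

/-- The sectional curvature of the plane spanned by two linearly independent vectors `u`, `v`. -/
def sectionalCurvature
    (cov : CovariantDerivative (𝓡 3) E3 (fun x : M => TangentSpace (𝓡 3) x))
    (x : M) (u v : TangentSpace (𝓡 3) x) : ℝ :=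
  inner ℝ (curvatureAt cov x u v v) u / (inner ℝ u u * inner ℝ v v - inner ℝ u v ^ 2)

end Ambient

/-! ### Oriented surfaces -/

section Surface

variable {M : Type*} [TopologicalSpace M] [ChartedSpace E3 M] [IsManifold (𝓡 3) ∞ M]
  [RiemannianBundle (fun x : M => TangentSpace (𝓡 3) x)]
  {S : Type*} [TopologicalSpace S] [ChartedSpace E2 S] [IsManifold (𝓡 2) ∞ S]

variable (M S) in
/-- An oriented smooth surface embedded in `M`, given by a smooth embedding and the smooth unit
normal field that determines the orientation: a tangent frame `(e₁, e₂)` is oriented iff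
`(N, e₁, e₂)` is an oriented frame of `M`. -/
structure OrientedSurface where
  emb : S → M
  isSmoothEmbedding : IsSmoothEmbedding (𝓡 2) (𝓡 3) ∞ emb
  normal : Π p : S, TangentSpace (𝓡 3) (emb p)
  contMDiff_normal : ContMDiff (𝓡 2) (𝓡 3).tangent ∞
    (fun p => (⟨emb p, normal p⟩ : TangentBundle (𝓡 3) M))
  norm_normal : ∀ p, ‖normal p‖ = 1
  inner_normal : ∀ p (u : TangentSpace (𝓡 2) p),
    inner ℝ (normal p) (mfderiv (𝓡 2) (𝓡 3) emb p u) = 0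

namespace OrientedSurface

variable (F : OrientedSurface M S)

/-- The tangent plane of the surface at `p`, as a subspace of the ambient tangent space. -/
def tangentPlane (p : S) : Submodule ℝ (TangentSpace (𝓡 3) (F.emb p)) :=
  LinearMap.range (mfderiv (𝓡 2) (𝓡 3) F.emb p).toLinearMap

/-- `Y` is a vector field on `M`, smooth near the point `p` of the surface, with value `v` at `p`,
and tangent to the surface along the surface near `p`. -/
def IsTangentExtension (p : S) (v : TangentSpace (𝓡 3) (F.emb p))
    (Y : Π x : M, TangentSpace (𝓡 3) x) : Prop :=
  ContMDiffAt (𝓡 3) (𝓡 3).tangent ∞ (fun x => (⟨x, Y x⟩ : TangentBundle (𝓡 3) M)) (F.emb p) ∧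
    Y (F.emb p) = v ∧ ∀ᶠ q in 𝓝 p, Y (F.emb q) ∈ F.tangentPlane q

/-- A choice of smooth extension of a tangent vector `v` of the surface. -/
def tangentExtension (p : S) (v : TangentSpace (𝓡 3) (F.emb p)) :
    Π x : M, TangentSpace (𝓡 3) x :=
  Classical.epsilon (F.IsTangentExtension p v)

variable (cov : CovariantDerivative (𝓡 3) E3 (fun x : M => TangentSpace (𝓡 3) x))

/-- The scalar second fundamental form `II(u,v) = ⟨N, ∇_u V⟩` of tangent vectors `u`, `v` at `p`,
where `V` is a smooth extension of `v` tangent to the surface. -/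
def secondFundamentalForm (p : S) (u v : TangentSpace (𝓡 3) (F.emb p)) : ℝ :=
  inner ℝ (F.normal p) (cov (F.tangentExtension p v) (F.emb p) u)

/-- The mean curvature `H = tr W`, where `II(u,v) = ⟨W u, v⟩` on the tangent plane. -/
def meanCurvature (p : S) : ℝ :=
  ∑ i, F.secondFundamentalForm cov p
    (stdOrthonormalBasis ℝ (F.tangentPlane p) i : TangentSpace (𝓡 3) (F.emb p))
    (stdOrthonormalBasis ℝ (F.tangentPlane p) i : TangentSpace (𝓡 3) (F.emb p))

/-- The torsion 2-form `τ(u,v) = ⟨N, T(u,v)⟩`. -/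
def torsionForm (p : S) (u v : TangentSpace (𝓡 3) (F.emb p)) : ℝ :=
  inner ℝ (F.normal p) (cov.torsion (F.emb p) u v)

variable (o : ManifoldOrientation M)

/-- The area form of the oriented surface: `dA(u,v) = vol (N,u,v)`. -/
def areaForm (p : S) (u v : TangentSpace (𝓡 3) (F.emb p)) : ℝ :=
  (o.at_ (F.emb p)).volumeForm ![F.normal p, u, v]

/-- The Hodge dual `⋆τ` of the torsion 2-form, i.e. the inner product of the 2-forms `τ` and `dA`,
`⋆τ = (1/2) ∑ τ(eᵢ,eⱼ) dA(eᵢ,eⱼ)` for an orthonormal basis `(e₁,e₂)` of the tangent plane; thus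
`⋆τ = τ(e₁,e₂)` if `(e₁,e₂)` is oriented. -/
def starTorsion (p : S) : ℝ :=
  (1 / 2) * ∑ i, ∑ j,
    F.torsionForm cov p
      (stdOrthonormalBasis ℝ (F.tangentPlane p) i : TangentSpace (𝓡 3) (F.emb p))
      (stdOrthonormalBasis ℝ (F.tangentPlane p) j : TangentSpace (𝓡 3) (F.emb p)) *
    F.areaForm o p
      (stdOrthonormalBasis ℝ (F.tangentPlane p) i : TangentSpace (𝓡 3) (F.emb p))
      (stdOrthonormalBasis ℝ (F.tangentPlane p) j : TangentSpace (𝓡 3) (F.emb p))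

/-- The complex mean curvature `𝐇 = H + i ⋆τ`. -/
def complexMeanCurvature (p : S) : ℂ :=
  (F.meanCurvature cov p : ℂ) + Complex.I * (F.starTorsion cov o p : ℂ)

/-- The coordinate vector of a chart `z : S ⊇ U → ℂ` at `p` in the direction `a : ℂ`, as an ambient
vector: `∂/∂x` for `a = 1` and `∂/∂y` for `a = i`, where `z = x + i y`. -/
def coordVec (z : OpenPartialHomeomorph S ℂ) (p : S) (a : ℂ) :
    TangentSpace (𝓡 3) (F.emb p) :=
  mfderiv (𝓡 2) (𝓡 3) F.emb p (mfderiv 𝓘(ℝ, ℂ) (𝓡 2) z.symm (z p) a)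

/-- `z` is a local complex chart for the complex structure that the surface inherits from its
conformal structure and its orientation: a diffeomorphism from an open subset of `S` onto an open
subset of `ℂ` which is conformal and orientation-preserving. -/
def IsComplexChart (z : OpenPartialHomeomorph S ℂ) : Prop :=
  ContMDiffOn (𝓡 2) 𝓘(ℝ, ℂ) ∞ z z.source ∧ ContMDiffOn 𝓘(ℝ, ℂ) (𝓡 2) ∞ z.symm z.target ∧
  ∀ p ∈ z.source,
    ‖F.coordVec z p 1‖ = ‖F.coordVec z p Complex.I‖ ∧
    inner ℝ (F.coordVec z p 1) (F.coordVec z p Complex.I) = 0 ∧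
    0 < F.areaForm o p (F.coordVec z p 1) (F.coordVec z p Complex.I)

/-- A function on the surface is holomorphic if it is so in every local complex chart. -/
def IsHolomorphic (h : S → ℂ) : Prop :=
  ∀ z : OpenPartialHomeomorph S ℂ, F.IsComplexChart o z →
    DifferentiableOn ℂ (h ∘ z.symm) z.target

/-- The coefficient `II(∂/∂z, ∂/∂z)` of the Hopf differential in the chart `z = x + i y`, where
`∂/∂z = (∂/∂x - i ∂/∂y) / 2` and `II` is extended complex-bilinearly. -/
def hopfCoeff (z : OpenPartialHomeomorph S ℂ) (p : S) : ℂ :=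
  (1 / 4) *
    (((F.secondFundamentalForm cov p (F.coordVec z p 1) (F.coordVec z p 1) : ℝ) : ℂ)
      - Complex.I *
        ((F.secondFundamentalForm cov p (F.coordVec z p 1) (F.coordVec z p Complex.I) : ℝ) : ℂ)
      - Complex.I *
        ((F.secondFundamentalForm cov p (F.coordVec z p Complex.I) (F.coordVec z p 1) : ℝ) : ℂ)
      - ((F.secondFundamentalForm cov p (F.coordVec z p Complex.I)
          (F.coordVec z p Complex.I) : ℝ) : ℂ))

/-- The Hopf differential `II(∂/∂z, ∂/∂z) dz²` is a holomorphic quadratic differential: its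
coefficient in every local complex chart is holomorphic. -/
def HopfDifferentialIsHolomorphic : Prop :=
  ∀ z : OpenPartialHomeomorph S ℂ, F.IsComplexChart o z →
    DifferentiableOn ℂ (F.hopfCoeff cov z ∘ z.symm) z.target

end OrientedSurface

end Surface

end

/-! In a complex chart z = x + iy of S let e₁, e₂ be the coordinate fields, g (dx² + dy²) the metric
and hᵢⱼ = II(eᵢ, eⱼ). Since e₁ and e₂ commute, T(e₁, e₂) = ∇_{e₁} e₂ - ∇_{e₂} e₁, so τ(e₁, e₂) = h₁₂
- h₂₁. Thus 𝐇 = ((h₁₁ + h₂₂) + i (h₁₂ - h₂₁)) / g, while the Hopf coefficient is φ = ((h₁₁ - h₂₂) -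
i (h₁₂ + h₂₁)) / 4.

The hypotheses on M enter through two pointwise facts only. The torsion of two tangent vectors of S
is normal to S, because u × v is orthogonal to u and v; hence the connection induced on S is the
Levi-Civita connection of g. Moreover R(e₁, e₂)N is normal to S. In dimension 3 this is the Einstein
condition: in an orthonormal frame along e₁, e₂, N the trace Ric(e₂, N) = 0 reduces to the one term
containing ⟨R(e₁, e₂)N, e₁⟩, the others vanishing by skew-symmetry (`inner_curvatureAt_of_ricci`).
For constant sectional curvature it follows by polarization
(`inner_curvatureAt_of_sectionalCurvature`).

The Codazzi equations (`codazzi_of_conformal`) then contain no curvature term and only the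
Christoffel symbols of a conformal metric. They amount to ∂φ/∂z̄ = (g / 4) · conj(∂𝐇/∂z̄), so the
Cauchy-Riemann equations of φ and of 𝐇 are equivalent (`cauchyRiemann_iff_of_codazzi`). In the
torsion-free case 𝐇 = H is real, and a real holomorphic function is locally constant.

Since ∇ differentiates ambient fields, e₁, e₂ and N are first extended to a neighbourhood in M
(`exists_adapted_fields`, `exists_normal_extension`); identities that hold only along S are
differentiated only in tangential directions. -/

noncomputable section

set_option linter.unusedSectionVars false

/-! ### Locally smooth fields and functions, and the locality of the connection. -/

section VectorFields

open VectorField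

variable {M : Type*} [TopologicalSpace M] [ChartedSpace E3 M]

/-- A vector field which is smooth on a neighbourhood of `x`. -/
def SmoothFieldNear [IsManifold (𝓡 3) ∞ M] (X : Π x : M, TangentSpace (𝓡 3) x) (x : M) : Prop :=
  ∀ᶠ y in 𝓝 x, ContMDiffAt (𝓡 3) (𝓡 3).tangent ∞
    (fun y => (⟨y, X y⟩ : TangentBundle (𝓡 3) M)) y

/-- A real function which is smooth on a neighbourhood of `x`. -/
def SmoothFunNear (f : M → ℝ) (x : M) : Prop :=
  ∀ᶠ y in 𝓝 x, ContMDiffAt (𝓡 3) 𝓘(ℝ) ∞ f y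

namespace SmoothFunNear

variable {f g : M → ℝ} {x : M}

theorem contMDiffAt (hf : SmoothFunNear f x) : ContMDiffAt (𝓡 3) 𝓘(ℝ) ∞ f x := hf.self_of_nhds

theorem mdiff (hf : SmoothFunNear f x) : MDifferentiableAt (𝓡 3) 𝓘(ℝ) f x :=
  hf.contMDiffAt.mdifferentiableAt (by simp)

theorem eventually (hf : SmoothFunNear f x) : ∀ᶠ y in 𝓝 x, SmoothFunNear f y :=
  eventually_eventually_nhds.2 hf

theorem congr (hf : SmoothFunNear f x) (h : ∀ᶠ y in 𝓝 x, g y = f y) : SmoothFunNear g x := by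
  filter_upwards [hf, eventually_eventually_nhds.2 h] with y hy h'
  exact hy.congr_of_eventuallyEq h'

theorem mul (hf : SmoothFunNear f x) (hg : SmoothFunNear g x) :
    SmoothFunNear (fun y => f y * g y) x := by
  filter_upwards [hf, hg] with y h1 h2 using h1.mul h2

theorem inv (hf : SmoothFunNear f x) (h0 : f x ≠ 0) : SmoothFunNear (fun y => (f y)⁻¹) x := by
  filter_upwards [hf, hf.contMDiffAt.continuousAt.eventually_ne h0] with y h1 h2
  exact (contDiffAt_inv ℝ h2).contMDiffAt.comp y h1

theorem sqrt (hf : SmoothFunNear f x) (h0 : f x ≠ 0) :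
    SmoothFunNear (fun y => Real.sqrt (f y)) x := by
  filter_upwards [hf, hf.contMDiffAt.continuousAt.eventually_ne h0] with y h1 h2
  exact (Real.contDiffAt_sqrt h2).contMDiffAt.comp y h1

end SmoothFunNear

theorem mvfderiv_congr {f g : M → ℝ} {x : M} (h : ∀ᶠ y in 𝓝 x, f y = g y)
    (v : TangentSpace (𝓡 3) x) : mvfderiv (𝓡 3) f x v = mvfderiv (𝓡 3) g x v := by
  have h' : mfderiv (𝓡 3) 𝓘(ℝ) f x = mfderiv (𝓡 3) 𝓘(ℝ) g x :=
    Filter.EventuallyEq.mfderiv_eq h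
  exact DFunLike.congr_fun h' v

variable [IsManifold (𝓡 3) ∞ M]

namespace SmoothFieldNear

variable {X Y : Π x : M, TangentSpace (𝓡 3) x} {f : M → ℝ} {x : M}

theorem contMDiffAt (hX : SmoothFieldNear X x) : ContMDiffAt (𝓡 3) (𝓡 3).tangent ∞
    (fun y => (⟨y, X y⟩ : TangentBundle (𝓡 3) M)) x := hX.self_of_nhds

theorem mdiff (hX : SmoothFieldNear X x) : MDifferentiableAt (𝓡 3) (𝓡 3).tangent
    (fun y => (⟨y, X y⟩ : TangentBundle (𝓡 3) M)) x := hX.contMDiffAt.mdifferentiableAt (by simp)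

theorem eventually (hf : SmoothFieldNear X x) : ∀ᶠ y in 𝓝 x, SmoothFieldNear X y :=
  eventually_eventually_nhds.2 hf

theorem congr (hX : SmoothFieldNear X x) (h : ∀ᶠ y in 𝓝 x, Y y = X y) : SmoothFieldNear Y x := by
  filter_upwards [hX, eventually_eventually_nhds.2 h] with y hy h'
  exact hy.congr_of_eventuallyEq (h'.mono fun z hz => by simp only [hz])

theorem add (hX : SmoothFieldNear X x) (hY : SmoothFieldNear Y x) :
    SmoothFieldNear (fun y => X y + Y y) x := by
  filter_upwards [hX, hY] with y h1 h2 using h1.add_section h2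

theorem sub (hX : SmoothFieldNear X x) (hY : SmoothFieldNear Y x) :
    SmoothFieldNear (fun y => X y - Y y) x := by
  filter_upwards [hX, hY] with y h1 h2 using h1.sub_section h2

theorem smul (hf : SmoothFunNear f x) (hX : SmoothFieldNear X x) :
    SmoothFieldNear (fun y => f y • X y) x := by
  filter_upwards [hf, hX] with y h1 h2 using h1.smul_section h2

theorem sum {ι : Type*} {s : Finset ι} {X : ι → Π x : M, TangentSpace (𝓡 3) x}
    (hX : ∀ i ∈ s, SmoothFieldNear (X i) x) :
    SmoothFieldNear (fun y => ∑ i ∈ s, X i y) x := by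
  have : ∀ᶠ y in 𝓝 x, ∀ i ∈ s, ContMDiffAt (𝓡 3) (𝓡 3).tangent ∞
    (fun y => (⟨y, X i y⟩ : TangentBundle (𝓡 3) M)) y :=
    (Filter.eventually_all_finset s).2 hX
  filter_upwards [this] with y h1 using .sum_section h1

theorem extend (v : TangentSpace (𝓡 3) x) : SmoothFieldNear (FiberBundle.extend E3 v) x := by
  obtain ⟨s, hs, h⟩ := FiberBundle.exists_contMDiffOn_extend (k := ∞) (𝓡 3) E3 v
  filter_upwards [eventually_mem_nhds_iff.2 hs] with y hy using h.contMDiffAt hy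

theorem inner [RiemannianBundle (fun x : M => TangentSpace (𝓡 3) x)]
    [IsContMDiffRiemannianBundle (𝓡 3) ∞ E3 (fun x : M => TangentSpace (𝓡 3) x)]
    (hX : SmoothFieldNear X x) (hY : SmoothFieldNear Y x) :
    SmoothFunNear (fun y => inner ℝ (X y) (Y y)) x := by
  filter_upwards [hX, hY] with y h1 h2 using h1.inner_bundle h2

/-- Multiply by a bump function supported where `X` is smooth. The smoothness of `cov` is applied to
globally smooth fields, so `cov_hom` needs this replacement to reach fields that are only locally
smooth. -/
theorem exists_contMDiff_eventuallyEq [T2Space M] (hX : SmoothFieldNear X x) :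
    ∃ Y : Π x : M, TangentSpace (𝓡 3) x, ContMDiff (𝓡 3) (𝓡 3).tangent ∞
      (fun y => (⟨y, Y y⟩ : TangentBundle (𝓡 3) M)) ∧ ∀ᶠ y in 𝓝 x, Y y = X y := by
  obtain ⟨u, hu, huo, hxu⟩ := eventually_nhds_iff.1 hX
  obtain ⟨φ, -, hφ⟩ := (SmoothBumpFunction.nhds_basis_tsupport (I := 𝓡 3) x).mem_iff.1
    (huo.mem_nhds hxu)
  refine ⟨(φ : M → ℝ) • X, ContMDiffOn.smul_section_of_tsupport (u := u)
    φ.contMDiff.contMDiffOn huo hφ fun y hy => (hu y hy).contMDiffWithinAt, ?_⟩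
  filter_upwards [φ.eventuallyEq_one] with y hy
  simp [hy]

variable (cov : CovariantDerivative (𝓡 3) E3 (fun x : M => TangentSpace (𝓡 3) x))

theorem cov_congr (hX : SmoothFieldNear X x) (h : ∀ᶠ y in 𝓝 x, Y y = X y) : cov Y x = cov X x :=
  cov.isCovariantDerivativeOn.congr_of_eventuallyEq (s := Set.univ) (hX.congr h).mdiff hX.mdiff
    Filter.univ_mem h

theorem cov_hom [T2Space M] [h : cov.ContMDiffCovariantDerivative ∞] (hX : SmoothFieldNear X x) :
    ContMDiffAt (𝓡 3) ((𝓡 3).prod 𝓘(ℝ, E3 →L[ℝ] E3)) ∞ (fun y => (⟨y, cov X y⟩ :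
      TotalSpace (E3 →L[ℝ] E3) fun x : M ↦ TangentSpace (𝓡 3) x →L[ℝ] TangentSpace (𝓡 3) x))
      x := by
  obtain ⟨Y, hY, hXY⟩ := hX.exists_contMDiff_eventuallyEq
  have := (h.contMDiff.contMDiff (σ := Y) hY.contMDiffOn).contMDiffAt (x := x) Filter.univ_mem
  refine this.congr_of_eventuallyEq ?_
  filter_upwards [hX.eventually, eventually_eventually_nhds.2 hXY] with y h1 h2
  rw [h1.cov_congr cov h2]

theorem covDeriv [T2Space M] [cov.ContMDiffCovariantDerivative ∞]
    (hX : SmoothFieldNear X x) (hY : SmoothFieldNear Y x) :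
    SmoothFieldNear (fun y => cov X y (Y y)) x := by
  filter_upwards [hX.eventually, hY] with y h1 h2
  exact (h1.cov_hom cov).clm_bundle_apply h2

end SmoothFieldNear

/-! ### Coordinate fields of a smooth chart with values in any normed space. -/

section Coordinates

variable {V : Type*} [NormedAddCommGroup V] [NormedSpace ℝ V]

/-- The constant vector field of a normed space. -/
def constField (a : V) (y : V) : TangentSpace 𝓘(ℝ, V) y := a

/-- The vector field of a chart `C` with constant coordinates `a`. -/
def coordField (C : OpenPartialHomeomorph M V) (a : V) (x : M) : TangentSpace (𝓡 3) x :=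
  mpullback (𝓡 3) 𝓘(ℝ, V) C (constField a) x

variable {C : OpenPartialHomeomorph M V} {x : M}

omit [IsManifold (𝓡 3) ∞ M] in
theorem mdiff_chart (hC : ContMDiffOn (𝓡 3) 𝓘(ℝ, V) ∞ C C.source) (hx : x ∈ C.source) :
    MDifferentiableAt (𝓡 3) 𝓘(ℝ, V) C x :=
  (hC.contMDiffAt (C.open_source.mem_nhds hx)).mdifferentiableAt (by simp)

omit [IsManifold (𝓡 3) ∞ M] in
theorem mdiff_chart_symm (hC' : ContMDiffOn 𝓘(ℝ, V) (𝓡 3) ∞ C.symm C.target)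
    (hx : x ∈ C.source) :
    MDifferentiableAt 𝓘(ℝ, V) (𝓡 3) C.symm (C x) :=
  (hC'.contMDiffAt (C.open_target.mem_nhds (C.map_source hx))).mdifferentiableAt (by simp)

/-- The derivative of a chart, as a linear equivalence. -/
def chartDeriv (hC : ContMDiffOn (𝓡 3) 𝓘(ℝ, V) ∞ C C.source)
    (hC' : ContMDiffOn 𝓘(ℝ, V) (𝓡 3) ∞ C.symm C.target) (hx : x ∈ C.source) :
    TangentSpace (𝓡 3) x ≃L[ℝ] TangentSpace 𝓘(ℝ, V) (C x) :=
  ContinuousLinearEquiv.equivOfInverse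
    (mfderiv (𝓡 3) 𝓘(ℝ, V) C x) (mfderiv 𝓘(ℝ, V) (𝓡 3) C.symm (C x))
    (fun v => by
      have h := mfderiv_comp_of_eq (mdiff_chart_symm hC' hx) (mdiff_chart hC hx) rfl
      have h2 : mfderiv (𝓡 3) (𝓡 3) (C.symm ∘ C) x = ContinuousLinearMap.id ℝ _ := by
        rw [← mfderiv_id]
        exact Filter.EventuallyEq.mfderiv_eq (C.eventually_left_inverse hx)
      rw [h2] at h
      exact (DFunLike.congr_fun h v).symm)
    (fun v => by
      have h := mfderiv_comp_of_eq (I := 𝓘(ℝ, V)) (I' := 𝓡 3) (I'' := 𝓘(ℝ, V)) (x := C x)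
        (f := C.symm) (g := C) (y := x)
        (mdiff_chart hC hx) (mdiff_chart_symm hC' hx) (C.left_inv hx)
      have h2 : mfderiv 𝓘(ℝ, V) 𝓘(ℝ, V) (C ∘ C.symm) (C x) = ContinuousLinearMap.id ℝ _ := by
        rw [← mfderiv_id]
        exact Filter.EventuallyEq.mfderiv_eq (C.eventually_right_inverse (C.map_source hx))
      rw [h2] at h
      have h3 := DFunLike.congr_fun h v
      rw [C.left_inv hx] at h3
      exact h3.symm)

omit [IsManifold (𝓡 3) ∞ M] in
theorem coordField_eq_chartDeriv_symm (hC : ContMDiffOn (𝓡 3) 𝓘(ℝ, V) ∞ C C.source)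
    (hC' : ContMDiffOn 𝓘(ℝ, V) (𝓡 3) ∞ C.symm C.target) (hx : x ∈ C.source) (a : V) :
    coordField C a x = (chartDeriv hC hC' hx).symm (constField a (C x)) := by
  have : mfderiv (𝓡 3) 𝓘(ℝ, V) C x = (chartDeriv hC hC' hx : _ →L[ℝ] _) := rfl
  rw [coordField, mpullback_apply, this, ContinuousLinearMap.inverse_equiv]
  rfl

omit [IsManifold (𝓡 3) ∞ M] in
theorem coordField_eq_of_mfderiv (hC : ContMDiffOn (𝓡 3) 𝓘(ℝ, V) ∞ C C.source)
    (hC' : ContMDiffOn 𝓘(ℝ, V) (𝓡 3) ∞ C.symm C.target) (hx : x ∈ C.source) {a : V}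
    {v : TangentSpace (𝓡 3) x} (h : mfderiv (𝓡 3) 𝓘(ℝ, V) C x v = a) :
    coordField C a x = v := by
  rw [coordField_eq_chartDeriv_symm hC hC' hx, ContinuousLinearEquiv.symm_apply_eq]
  exact h.symm

omit [IsManifold (𝓡 3) ∞ M] in
theorem exists_coordField_eq (hC : ContMDiffOn (𝓡 3) 𝓘(ℝ, V) ∞ C C.source)
    (hC' : ContMDiffOn 𝓘(ℝ, V) (𝓡 3) ∞ C.symm C.target) (hx : x ∈ C.source)
    (v : TangentSpace (𝓡 3) x) : ∃ a : V, coordField C a x = v :=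
  ⟨_, coordField_eq_of_mfderiv hC hC' hx rfl⟩

omit [IsManifold (𝓡 3) ∞ M] in
theorem contDiffAt_chart_symm (hC' : ContMDiffOn 𝓘(ℝ, V) (𝓡 3) ∞ C.symm C.target)
    (hx : x ∈ C.source) {h : M → ℝ} (hh : ContMDiffAt (𝓡 3) 𝓘(ℝ) ∞ h x) :
    ContDiffAt ℝ ∞ (h ∘ C.symm) (C x) := by
  rw [← contMDiffAt_iff_contDiffAt]
  exact ContMDiffAt.comp_of_eq hh
    (hC'.contMDiffAt (C.open_target.mem_nhds (C.map_source hx))) (C.left_inv hx)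

omit [IsManifold (𝓡 3) ∞ M] in
theorem mvfderiv_coordField (hC : ContMDiffOn (𝓡 3) 𝓘(ℝ, V) ∞ C C.source)
    (hC' : ContMDiffOn 𝓘(ℝ, V) (𝓡 3) ∞ C.symm C.target) (hx : x ∈ C.source) (a : V)
    {h : M → ℝ} (hh : MDifferentiableAt (𝓡 3) 𝓘(ℝ) h x) :
    mvfderiv (𝓡 3) h x (coordField C a x) = fderiv ℝ (h ∘ C.symm) (C x) a := by
  have h1 : MDifferentiableAt 𝓘(ℝ, V) 𝓘(ℝ) (h ∘ C.symm) (C x) :=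
    MDifferentiableAt.comp_of_eq (C x) hh (mdiff_chart_symm hC' hx) (C.left_inv hx)
  have h2 := mfderiv_comp_of_eq (g := h ∘ C.symm) (f := C) (x := x) h1 (mdiff_chart hC hx) rfl
  have h3 : mfderiv (𝓡 3) 𝓘(ℝ) ((h ∘ C.symm) ∘ C) x = mfderiv (𝓡 3) 𝓘(ℝ) h x :=
    Filter.EventuallyEq.mfderiv_eq
      ((C.eventually_left_inverse hx).mono fun y hy => congrArg h hy)
  have h4 : mfderiv (𝓡 3) 𝓘(ℝ, V) C x (coordField C a x) = a := by
    rw [coordField_eq_chartDeriv_symm hC hC' hx]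
    exact (chartDeriv hC hC' hx).apply_symm_apply a
  rw [mfderiv_eq_fderiv] at h2
  have h5 := DFunLike.congr_fun (h3.symm.trans h2) (coordField C a x)
  refine Eq.trans (h5 : _) ?_
  exact congrArg (fderiv ℝ (h ∘ C.symm) (C x)) h4

omit [IsManifold (𝓡 3) ∞ M] in
theorem SmoothFunNear.eventually_mvfderiv_coordField
    (hC : ContMDiffOn (𝓡 3) 𝓘(ℝ, V) ∞ C C.source)
    (hC' : ContMDiffOn 𝓘(ℝ, V) (𝓡 3) ∞ C.symm C.target) (hx : x ∈ C.source) (a : V)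
    {h : M → ℝ} (hh : SmoothFunNear h x) :
    ∀ᶠ y in 𝓝 x, mvfderiv (𝓡 3) h y (coordField C a y) = fderiv ℝ (h ∘ C.symm) (C y) a := by
  filter_upwards [hh, C.open_source.mem_nhds hx] with y h1 h2
  exact _root_.mvfderiv_coordField hC hC' h2 a (h1.mdifferentiableAt (by simp))

omit [IsManifold (𝓡 3) ∞ M] in
theorem SmoothFunNear.mvfderiv_coordField (hC : ContMDiffOn (𝓡 3) 𝓘(ℝ, V) ∞ C C.source)
    (hC' : ContMDiffOn 𝓘(ℝ, V) (𝓡 3) ∞ C.symm C.target) (hx : x ∈ C.source) (a : V)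
    {h : M → ℝ} (hh : SmoothFunNear h x) :
    SmoothFunNear (fun y => mvfderiv (𝓡 3) h y (coordField C a y)) x := by
  refine SmoothFunNear.congr ?_ (hh.eventually_mvfderiv_coordField hC hC' hx a)
  filter_upwards [hh, C.open_source.mem_nhds hx] with y h1 h2
  have hc := contDiffAt_chart_symm hC' h2 h1
  have : ContDiffAt ℝ ∞ (fun w => fderiv ℝ (h ∘ C.symm) w a) (C y) :=
    (hc.fderiv_right (m := ∞) (by simp)).clm_apply contDiffAt_const
  exact this.contMDiffAt.comp y (hC.contMDiffAt (C.open_source.mem_nhds h2))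

omit [IsManifold (𝓡 3) ∞ M] in
-- In the chart both sides are values of the second derivative of `h ∘ C.symm`, which is symmetric.
-- This takes the place of XYh - YXh = [X,Y]h for commuting fields.
theorem coordField_second_symm (hC : ContMDiffOn (𝓡 3) 𝓘(ℝ, V) ∞ C C.source)
    (hC' : ContMDiffOn 𝓘(ℝ, V) (𝓡 3) ∞ C.symm C.target) (hx : x ∈ C.source) (a b : V)
    {h : M → ℝ} (hh : SmoothFunNear h x) :
    mvfderiv (𝓡 3) (fun y => mvfderiv (𝓡 3) h y (coordField C b y)) x (coordField C a x) =
    mvfderiv (𝓡 3) (fun y => mvfderiv (𝓡 3) h y (coordField C a y)) x (coordField C b x) := by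
  have hc := contDiffAt_chart_symm hC' hx hh.contMDiffAt
  have key : ∀ a b : V,
      mvfderiv (𝓡 3) (fun y => mvfderiv (𝓡 3) h y (coordField C b y)) x (coordField C a x) =
      fderiv ℝ (fderiv ℝ (h ∘ C.symm)) (C x) a b := by
    intro a b
    have e1 := hh.eventually_mvfderiv_coordField hC hC' hx b
    have hd : DifferentiableAt ℝ (fderiv ℝ (h ∘ C.symm)) (C x) :=
      (hc.fderiv_right (m := 1) (by norm_cast)).differentiableAt (by simp)
    have e2 := (hh.mvfderiv_coordField hC hC' hx b).mdiff
    rw [mvfderiv_coordField hC hC' hx a e2]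
    have e3 : (fun y => mvfderiv (𝓡 3) h y (coordField C b y)) ∘ C.symm =ᶠ[𝓝 (C x)]
        fun w => fderiv ℝ (h ∘ C.symm) w b := by
      have := (C.symm.continuousAt (C.map_source hx)).eventually
        (by rw [C.left_inv hx]; exact e1)
      filter_upwards [this, C.eventually_right_inverse (C.map_source hx)] with w h1 h2
      rw [Function.comp_apply, h1, h2]
    rw [e3.fderiv_eq, fderiv_clm_apply hd (differentiableAt_const _)]
    simp
  rw [key, key]
  exact (hc.isSymmSndFDerivAt (by simp; norm_cast)) a b

theorem SmoothFieldNear.coordField [CompleteSpace V]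
    (hC : ContMDiffOn (𝓡 3) 𝓘(ℝ, V) ∞ C C.source)
    (hC' : ContMDiffOn 𝓘(ℝ, V) (𝓡 3) ∞ C.symm C.target) (hx : x ∈ C.source) (a : V) :
    SmoothFieldNear (coordField C a) x := by
  filter_upwards [C.open_source.mem_nhds hx] with y hy
  refine ContMDiffAt.mpullback_vectorField_preimage (n := ∞) (V := constField a) ?_
    (hC.contMDiffAt (C.open_source.mem_nhds hy)) ⟨chartDeriv hC hC' hy, rfl⟩ (by simp)
  exact contMDiffAt_vectorSpace_iff_contDiffAt.2 contDiffAt_const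

/-- Brackets commute with pullback, and constant fields have bracket zero. -/
theorem mlieBracket_coordField [CompleteSpace V]
    (hC : ContMDiffOn (𝓡 3) 𝓘(ℝ, V) ∞ C C.source)
    (hx : x ∈ C.source) (a b : V) :
    mlieBracket (𝓡 3) (coordField C a) (coordField C b) x = 0 := by
  have h : ∀ a : V, MDifferentiableAt 𝓘(ℝ, V) 𝓘(ℝ, V).tangent
      (fun y => (⟨y, constField a y⟩ : TangentBundle 𝓘(ℝ, V) V)) (C x) := fun a =>
    ((contMDiffAt_vectorSpace_iff_contDiffAt (n := 1)).2
      contDiffAt_const).mdifferentiableAt (by simp)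
  have : IsManifold (𝓡 3) (minSmoothness ℝ 2) M := by
    rw [minSmoothness_of_isRCLikeNormedField]
    infer_instance
  have := mpullback_mlieBracket (n := ∞) (h a) (h b)
    (hC.contMDiffAt (C.open_source.mem_nhds hx)) (by simp; norm_cast)
  refine this.symm.trans ?_
  have h0 : lieBracket ℝ (constField a) (constField b) (C x) = 0 := by
    change fderiv ℝ (fun _ : V => b) _ _ - fderiv ℝ (fun _ : V => a) _ _ = 0
    simp only [fderiv_fun_const]
    exact sub_self (0 : V)
  have h1 : mlieBracket 𝓘(ℝ, V) (constField a) (constField b) (C x) = 0 := by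
    rw [← mlieBracketWithin_univ, mlieBracketWithin_eq_lieBracketWithin]
    exact (congrFun (lieBracketWithin_univ (𝕜 := ℝ) (E := V) (V := fun _ => a)
      (W := fun _ => b)) (C x)).trans h0
  rw [mpullback_apply, h1, map_zero]

end Coordinates
end VectorFields

/-! ### The curvature of a smooth connection is a tensor. -/

section Curvature

open VectorField

variable {M : Type*} [TopologicalSpace M] [T2Space M] [ChartedSpace E3 M] [IsManifold (𝓡 3) ∞ M]
  [RiemannianBundle (fun x : M => TangentSpace (𝓡 3) x)]
  (cov : CovariantDerivative (𝓡 3) E3 (fun x : M => TangentSpace (𝓡 3) x))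

theorem SmoothFieldNear.mdiff_covDeriv [h : cov.ContMDiffCovariantDerivative ∞] {x : M}
    {Z X : Π x : M, TangentSpace (𝓡 3) x} (hZ : SmoothFieldNear Z x)
    (hX : MDifferentiableAt (𝓡 3) (𝓡 3).tangent
      (fun y => (⟨y, X y⟩ : TangentBundle (𝓡 3) M)) x) :
    MDifferentiableAt (𝓡 3) (𝓡 3).tangent
      (fun y => (⟨y, cov Z y (X y)⟩ : TangentBundle (𝓡 3) M)) x :=
  ((hZ.cov_hom cov).mdifferentiableAt (by simp)).clm_bundle_apply hX

variable {X Y Z : Π x : M, TangentSpace (𝓡 3) x} {x : M}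

omit [T2Space M] in
theorem curvatureField_swap (X Y Z : Π x : M, TangentSpace (𝓡 3) x) (x : M) :
    curvatureField cov X Y Z x = - curvatureField cov Y X Z x := by
  simp only [curvatureField, mlieBracket_swap_apply (V := X) (W := Y), map_neg]
  abel

/-- The term (Yf) ∇_X Z produced by ∇_Y (f ∇_X Z) cancels the one produced by [fX, Y]. -/
theorem tensorialAt_curvatureField_left [cov.ContMDiffCovariantDerivative ∞]
    (Y : Π x : M, TangentSpace (𝓡 3) x) (hZ : SmoothFieldNear Z x) :
    TensorialAt (𝓡 3) E3 (fun X => curvatureField cov X Y Z x) x where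
  smul {f X} hf hX := by
    have h1 : (fun y => cov Z y ((f • X) y)) = f • (fun y => cov Z y (X y)) := by
      ext1 y
      simp
    have h2 := cov.isCovariantDerivativeOn.leibniz (s := Set.univ)
      (hZ.mdiff_covDeriv cov hX) hf
    simp only [curvatureField, h1]
    rw [h2, mlieBracket_smul_left hf hX]
    simp
    module
  add {X X'} hX hX' := by
    have h1 : (fun y => cov Z y ((X + X') y)) = (fun y => cov Z y (X y)) +
        (fun y => cov Z y (X' y)) := by
      ext1 y
      simp
    have h2 := cov.isCovariantDerivativeOn.add (s := Set.univ)
      (hZ.mdiff_covDeriv cov hX) (hZ.mdiff_covDeriv cov hX')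
    simp only [curvatureField, h1]
    rw [h2, mlieBracket_add_left hX hX']
    simp
    module

theorem tensorialAt_curvatureField_right [cov.ContMDiffCovariantDerivative ∞]
    (X : Π x : M, TangentSpace (𝓡 3) x) (hZ : SmoothFieldNear Z x) :
    TensorialAt (𝓡 3) E3 (fun Y => curvatureField cov X Y Z x) x where
  smul {f Y} hf hY := by
    have := (tensorialAt_curvatureField_left cov X hZ).smul hf hY
    simp only [curvatureField_swap cov _ X] at this
    simpa using this
  add {Y Y'} hY hY' := by
    have := (tensorialAt_curvatureField_left cov X hZ).add hY hY'
    simp only [curvatureField_swap cov _ X] at this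
    rw [← neg_inj, this]
    abel

/-- This permits replacing X and Y by coordinate fields of a chart, for which the bracket term
disappears. -/
theorem curvatureField_congr_left_right [cov.ContMDiffCovariantDerivative ∞]
    {X' Y' : Π x : M, TangentSpace (𝓡 3) x}
    (hX : SmoothFieldNear X x) (hX' : SmoothFieldNear X' x) (hY : SmoothFieldNear Y x)
    (hY' : SmoothFieldNear Y' x) (hZ : SmoothFieldNear Z x) (hXX' : X x = X' x)
    (hYY' : Y x = Y' x) :
    curvatureField cov X Y Z x = curvatureField cov X' Y' Z x :=
  TensorialAt.pointwise₂ (Φ := fun X Y => curvatureField cov X Y Z x)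
    (fun Y _ => tensorialAt_curvatureField_left cov Y hZ)
    (fun X _ => tensorialAt_curvatureField_right cov X hZ)
    hX.mdiff hX'.mdiff hY.mdiff hY'.mdiff hXX' hYY'

/-- The coordinate field of the preferred chart at `x` with prescribed value at `x`. -/
theorem exists_coordField_chartAt_eq (x : M) (v : TangentSpace (𝓡 3) x) :
    ∃ a : E3, coordField (chartAt E3 x) a x = v :=
  exists_coordField_eq contMDiffOn_chart contMDiffOn_chart_symm (mem_chart_source E3 x) v

variable (x) in
theorem smoothFieldNear_coordField_chartAt (a : E3) :
    SmoothFieldNear (coordField (chartAt E3 x) a) x :=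
  SmoothFieldNear.coordField contMDiffOn_chart contMDiffOn_chart_symm (mem_chart_source E3 x) a

variable (x) in
theorem mlieBracket_coordField_chartAt (a b : E3) :
    mlieBracket (𝓡 3) (coordField (chartAt E3 x) a) (coordField (chartAt E3 x) b) x = 0 :=
  mlieBracket_coordField contMDiffOn_chart (mem_chart_source E3 x) a b

theorem curvatureField_congr (hX : SmoothFieldNear X x) (hY : SmoothFieldNear Y x)
    [cov.ContMDiffCovariantDerivative ∞] {Z' : Π x : M, TangentSpace (𝓡 3) x}
    (hZ : SmoothFieldNear Z x) (h : ∀ᶠ y in 𝓝 x, Z' y = Z y) :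
    curvatureField cov X Y Z' x = curvatureField cov X Y Z x := by
  have h1 : ∀ᶠ y in 𝓝 x, cov Z' y = cov Z y := by
    filter_upwards [hZ.eventually, eventually_eventually_nhds.2 h] with y h1 h2
    exact h1.cov_congr cov h2
  simp only [curvatureField]
  rw [(hZ.covDeriv cov hY).cov_congr cov (Y := fun y => cov Z' y (Y y))
      (h1.mono fun y hy => by rw [hy]),
    (hZ.covDeriv cov hX).cov_congr cov (Y := fun y => cov Z' y (X y))
      (h1.mono fun y hy => by rw [hy]), h1.self_of_nhds]

theorem curvatureField_add (hX : SmoothFieldNear X x) (hY : SmoothFieldNear Y x)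
    [cov.ContMDiffCovariantDerivative ∞] {Z' : Π x : M, TangentSpace (𝓡 3) x}
    (hZ : SmoothFieldNear Z x) (hZ' : SmoothFieldNear Z' x) :
    curvatureField cov X Y (fun y => Z y + Z' y) x =
      curvatureField cov X Y Z x + curvatureField cov X Y Z' x := by
  have h1 : ∀ᶠ y in 𝓝 x, cov (fun y => Z y + Z' y) y = cov Z y + cov Z' y := by
    filter_upwards [hZ.eventually, hZ'.eventually] with y h1 h2
    exact cov.isCovariantDerivativeOn.add (s := Set.univ) h1.mdiff h2.mdiff
  have key : ∀ {X}, SmoothFieldNear X x → cov (fun y => cov (fun y => Z y + Z' y) y (X y)) x =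
      cov (fun y => cov Z y (X y)) x + cov (fun y => cov Z' y (X y)) x := by
    intro X hX
    rw [((hZ.covDeriv cov hX).add (hZ'.covDeriv cov hX)).cov_congr cov
      (h1.mono fun y hy => by rw [hy]; rfl)]
    exact cov.isCovariantDerivativeOn.add (s := Set.univ) (hZ.covDeriv cov hX).mdiff
      (hZ'.covDeriv cov hX).mdiff
  simp only [curvatureField]
  rw [key hX, key hY, h1.self_of_nhds]
  simp only [_root_.add_apply]
  abel

theorem curvatureField_zero (X Y : Π x : M, TangentSpace (𝓡 3) x) :
    curvatureField cov X Y (fun _ => 0) x = 0 := by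
  have h0 : cov (fun _ => 0) = 0 := cov.zero
  simp [curvatureField, h0]

theorem curvatureField_sum (hX : SmoothFieldNear X x) (hY : SmoothFieldNear Y x)
    [cov.ContMDiffCovariantDerivative ∞] {ι : Type*} (s : Finset ι)
    {Z : ι → Π x : M, TangentSpace (𝓡 3) x} (hZ : ∀ i, SmoothFieldNear (Z i) x) :
    curvatureField cov X Y (fun y => ∑ i ∈ s, Z i y) x =
      ∑ i ∈ s, curvatureField cov X Y (Z i) x := by
  classical
  induction s using Finset.induction_on with
  | empty => simp [curvatureField_zero]
  | insert a s ha ih =>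
    simp only [Finset.sum_insert ha]
    rw [curvatureField_add cov hX hY (hZ a) (.sum fun i _ => hZ i), ih]

theorem SmoothFieldNear.cov_smul {f : M → ℝ} (hf : SmoothFunNear f x) (hZ : SmoothFieldNear Z x)
    (v : TangentSpace (𝓡 3) x) :
    cov (fun y => f y • Z y) x v = f x • cov Z x v + mvfderiv (𝓡 3) f x v • Z x := by
  have := cov.isCovariantDerivativeOn.leibniz (s := Set.univ) hZ.mdiff hf.mdiff
  exact congr($this v)

theorem SmoothFieldNear.cov_add (hY : SmoothFieldNear Y x) (hZ : SmoothFieldNear Z x)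
    (v : TangentSpace (𝓡 3) x) :
    cov (fun y => Y y + Z y) x v = cov Y x v + cov Z x v :=
  congr($(cov.isCovariantDerivativeOn.add (s := Set.univ) hY.mdiff hZ.mdiff) v)

/-- For coordinate fields, the first-order terms in f of ∇_X ∇_Y (fZ) are symmetric in X and Y, and
so is the second derivative of f; both drop out of the commutator. -/
theorem curvatureField_smul [cov.ContMDiffCovariantDerivative ∞]
    (hX : SmoothFieldNear X x) (hY : SmoothFieldNear Y x)
    {f : M → ℝ} (hf : SmoothFunNear f x) (hZ : SmoothFieldNear Z x) :
    curvatureField cov X Y (fun y => f y • Z y) x = f x • curvatureField cov X Y Z x := by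
  obtain ⟨a, ha⟩ := exists_coordField_chartAt_eq x (X x)
  obtain ⟨b, hb⟩ := exists_coordField_chartAt_eq x (Y x)
  have hA := smoothFieldNear_coordField_chartAt x a
  have hB := smoothFieldNear_coordField_chartAt x b
  have hfZ := SmoothFieldNear.smul hf hZ
  rw [curvatureField_congr_left_right cov hX hA hY hB hfZ ha.symm hb.symm,
    curvatureField_congr_left_right cov hX hA hY hB hZ ha.symm hb.symm]
  have hdf : ∀ c, SmoothFunNear
      (fun y => mvfderiv (𝓡 3) f y (coordField (chartAt E3 x) c y)) x := fun c =>
    hf.mvfderiv_coordField contMDiffOn_chart contMDiffOn_chart_symm (mem_chart_source E3 x) c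
  have key : ∀ c d : E3, cov (fun y => cov (fun y => f y • Z y) y
        (coordField (chartAt E3 x) c y)) x (coordField (chartAt E3 x) d x) =
      f x • cov (fun y => cov Z y (coordField (chartAt E3 x) c y)) x
        (coordField (chartAt E3 x) d x)
      + (mvfderiv (𝓡 3) f x (coordField (chartAt E3 x) d x)) •
        cov Z x (coordField (chartAt E3 x) c x)
      + ((mvfderiv (𝓡 3) f x (coordField (chartAt E3 x) c x)) •
        cov Z x (coordField (chartAt E3 x) d x)
      + (mvfderiv (𝓡 3) (fun y => mvfderiv (𝓡 3) f y (coordField (chartAt E3 x) c y)) x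
        (coordField (chartAt E3 x) d x)) • Z x) := by
    intro c d
    have hc := smoothFieldNear_coordField_chartAt x c
    have h1 : ∀ᶠ y in 𝓝 x, cov (fun y => f y • Z y) y (coordField (chartAt E3 x) c y) =
        f y • cov Z y (coordField (chartAt E3 x) c y) +
        mvfderiv (𝓡 3) f y (coordField (chartAt E3 x) c y) • Z y := by
      filter_upwards [hf.eventually, hZ.eventually] with y h1 h2
      exact h2.cov_smul cov h1 _
    rw [(((SmoothFieldNear.smul hf (hZ.covDeriv cov hc)).add
      (SmoothFieldNear.smul (hdf c) hZ)).cov_congr cov h1),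
      (SmoothFieldNear.smul hf (hZ.covDeriv cov hc)).cov_add cov
      (SmoothFieldNear.smul (hdf c) hZ), (hZ.covDeriv cov hc).cov_smul cov hf,
      hZ.cov_smul cov (hdf c)]
  simp only [curvatureField]
  rw [key, key, mlieBracket_coordField_chartAt, map_zero, map_zero,
    coordField_second_symm contMDiffOn_chart contMDiffOn_chart_symm (mem_chart_source E3 x) a b hf]
  module

/-- Expand Z in a local frame: its coefficient functions vanish at x, and by `curvatureField_smul`
they come out of the curvature. -/
theorem curvatureField_eq_zero [cov.ContMDiffCovariantDerivative ∞]
    (hX : SmoothFieldNear X x) (hY : SmoothFieldNear Y x)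
    (hZ : SmoothFieldNear Z x) (h : Z x = 0) : curvatureField cov X Y Z x = 0 := by
  let t := trivializationAt E3 (fun x : M => TangentSpace (𝓡 3) x) x
  have x_mem : x ∈ t.baseSet := FiberBundle.mem_baseSet_trivializationAt E3 _ x
  let b := Basis.ofVectorSpace ℝ E3
  have hs (i) : SmoothFieldNear (t.localFrame b i) x := by
    filter_upwards [t.open_baseSet.mem_nhds x_mem] with y hy
    exact contMDiffAt_localFrame_of_mem ∞ _ b i hy
  have hc (i) : SmoothFunNear (LinearMap.piApply (t.localFrameCoeff (𝓡 3) b i) Z) x := by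
    filter_upwards [t.open_baseSet.mem_nhds x_mem, hZ] with y hy h1
    exact contMDiffAt_localFrameCoeff b hy h1 i
  have hsum := t.eventually_eq_localFrame_sum_coeff_smul (I := 𝓡 3) (s := Z) b x_mem
  rw [curvatureField_congr cov hX hY (.sum fun i _ => .smul (hc i) (hs i)) hsum,
    curvatureField_sum cov hX hY _ fun i => .smul (hc i) (hs i)]
  refine Finset.sum_eq_zero fun i _ => ?_
  rw [curvatureField_smul cov hX hY (hc i) (hs i)]
  simp [LinearMap.piApply, h]

/-- The extensions chosen in `curvatureAt` are immaterial: in the last slot, the difference of two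
extensions vanishes at x, so `curvatureField_eq_zero` applies to it. -/
theorem curvatureField_eq_curvatureAt [cov.ContMDiffCovariantDerivative ∞]
    (hX : SmoothFieldNear X x) (hY : SmoothFieldNear Y x) (hZ : SmoothFieldNear Z x) :
    curvatureField cov X Y Z x = curvatureAt cov x (X x) (Y x) (Z x) := by
  rw [curvatureAt, curvatureField_congr_left_right cov (SmoothFieldNear.extend (X x)) hX
    (SmoothFieldNear.extend (Y x)) hY (SmoothFieldNear.extend (Z x)) (by simp) (by simp)]
  have hW := SmoothFieldNear.extend (Z x)
  have h0 := curvatureField_eq_zero cov hX hY (hZ.sub hW) (by simp)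
  have h1 := curvatureField_add cov hX hY (hZ.sub hW) hW
  simpa [h0] using h1

section CurvatureTensor

variable [cov.ContMDiffCovariantDerivative ∞] (u u' v w w' : TangentSpace (𝓡 3) x)

theorem curvatureAt_swap : curvatureAt cov x u v w = - curvatureAt cov x v u w :=
  curvatureField_swap cov _ _ _ _

theorem curvatureAt_add_left :
    curvatureAt cov x (u + u') v w = curvatureAt cov x u v w + curvatureAt cov x u' v w := by
  have h := (tensorialAt_curvatureField_left cov (FiberBundle.extend E3 v)
    (SmoothFieldNear.extend w)).add (SmoothFieldNear.extend u).mdiff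
    (SmoothFieldNear.extend u').mdiff
  refine Eq.trans ?_ h
  have := curvatureField_eq_curvatureAt cov ((SmoothFieldNear.extend u).add
    (SmoothFieldNear.extend u')) (SmoothFieldNear.extend v) (SmoothFieldNear.extend w)
  simp only [FiberBundle.extend_apply_self] at this
  exact this.symm

theorem curvatureAt_smul_left (c : ℝ) :
    curvatureAt cov x (c • u) v w = c • curvatureAt cov x u v w := by
  have hc : SmoothFunNear (fun _ : M => c) x := .of_forall fun _ => contMDiffAt_const
  have h := (tensorialAt_curvatureField_left cov (FiberBundle.extend E3 v)
    (SmoothFieldNear.extend w)).smul hc.mdiff (SmoothFieldNear.extend u).mdiff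
  refine Eq.trans ?_ h
  have := curvatureField_eq_curvatureAt cov (SmoothFieldNear.smul hc (SmoothFieldNear.extend u))
     (SmoothFieldNear.extend v) (SmoothFieldNear.extend w)
  simp only [FiberBundle.extend_apply_self] at this
  exact this.symm

theorem curvatureAt_add_right :
    curvatureAt cov x u v (w + w') = curvatureAt cov x u v w + curvatureAt cov x u v w' := by
  have hu := SmoothFieldNear.extend u
  have hv := SmoothFieldNear.extend v
  have hw := SmoothFieldNear.extend w
  have hw' := SmoothFieldNear.extend w'
  refine Eq.trans ?_ (curvatureField_add cov hu hv hw hw')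
  have := curvatureField_eq_curvatureAt cov hu hv (hw.add hw')
  simp only [FiberBundle.extend_apply_self] at this
  exact this.symm

end CurvatureTensor

end Curvature

/-! ### Symmetries of the curvature of a metric connection, and the orthogonality of R(u,v)n. -/

section MetricCurvature

open VectorField

variable {M : Type*} [TopologicalSpace M] [T2Space M] [ChartedSpace E3 M] [IsManifold (𝓡 3) ∞ M]
  [RiemannianBundle (fun x : M => TangentSpace (𝓡 3) x)]
  [IsContMDiffRiemannianBundle (𝓡 3) ∞ E3 (fun x : M => TangentSpace (𝓡 3) x)]
  {cov : CovariantDerivative (𝓡 3) E3 (fun x : M => TangentSpace (𝓡 3) x)}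
  [cov.ContMDiffCovariantDerivative ∞]
  {x : M}

/-- Compatibility of the connection with the metric, for fields that are smooth near a point. -/
theorem mvfderiv_inner_of_smoothFieldNear (hmetric : cov.IsMetricCompatible)
    {Y Z : Π x : M, TangentSpace (𝓡 3) x}
    (hY : SmoothFieldNear Y x) (hZ : SmoothFieldNear Z x) (v : TangentSpace (𝓡 3) x) :
    mvfderiv (𝓡 3) (fun y => inner ℝ (Y y) (Z y)) x v =
      inner ℝ (cov Y x v) (Z x) + inner ℝ (Y x) (cov Z x v) := by
  have := hmetric.mvfderiv_inner_eq (FiberBundle.extend E3 v) hY.mdiff hZ.mdiff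
  simpa using this

/-- Differentiate |W|² twice along coordinate fields. The second derivative is symmetric, and so is
the term ⟨∇_X W, ∇_Y W⟩; what remains is ⟨∇_X ∇_Y W, W⟩ = ⟨∇_Y ∇_X W, W⟩. -/
theorem inner_curvatureAt_self (hmetric : cov.IsMetricCompatible)
    (u v w : TangentSpace (𝓡 3) x) : inner ℝ (curvatureAt cov x u v w) w = 0 := by
  obtain ⟨a, ha⟩ := exists_coordField_chartAt_eq x u
  obtain ⟨b, hb⟩ := exists_coordField_chartAt_eq x v
  have hc := fun c => smoothFieldNear_coordField_chartAt x c
  have hW := SmoothFieldNear.extend w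
  have hR := curvatureField_eq_curvatureAt cov (hc a) (hc b) hW
  rw [ha, hb, FiberBundle.extend_apply_self] at hR
  have key : ∀ c d : E3, mvfderiv (𝓡 3) (fun y => mvfderiv (𝓡 3)
      (fun y => inner ℝ (FiberBundle.extend E3 w y) (FiberBundle.extend E3 w y)) y
        (coordField (chartAt E3 x) c y)) x (coordField (chartAt E3 x) d x) =
      2 * (inner ℝ (cov (fun y => cov (FiberBundle.extend E3 w) y
        (coordField (chartAt E3 x) c y)) x (coordField (chartAt E3 x) d x)) w +
      inner ℝ (cov (FiberBundle.extend E3 w) x (coordField (chartAt E3 x) c x))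
        (cov (FiberBundle.extend E3 w) x (coordField (chartAt E3 x) d x))) := by
    intro c d
    have h1 : ∀ᶠ y in 𝓝 x, mvfderiv (𝓡 3)
        (fun y => inner ℝ (FiberBundle.extend E3 w y) (FiberBundle.extend E3 w y)) y
        (coordField (chartAt E3 x) c y) =
        inner ℝ (cov (FiberBundle.extend E3 w) y (coordField (chartAt E3 x) c y))
          (FiberBundle.extend E3 w y) +
        inner ℝ (cov (FiberBundle.extend E3 w) y (coordField (chartAt E3 x) c y))
          (FiberBundle.extend E3 w y) := by
      filter_upwards [hW.eventually] with y hy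
      rw [mvfderiv_inner_of_smoothFieldNear hmetric hy hy, real_inner_comm (cov _ y _)]
    have h2 := (hW.covDeriv cov (hc c)).inner hW
    rw [mvfderiv_congr h1, mvfderiv_fun_add h2.mdiff h2.mdiff, _root_.add_apply,
      mvfderiv_inner_of_smoothFieldNear hmetric (hW.covDeriv cov (hc c)) hW,
      FiberBundle.extend_apply_self]
    ring
  have hs := coordField_second_symm (x := x) contMDiffOn_chart contMDiffOn_chart_symm
    (mem_chart_source E3 x) a b (hW.inner hW)
  rw [key, key, real_inner_comm (cov _ x (coordField _ a x))] at hs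
  rw [← hR, curvatureField, mlieBracket_coordField_chartAt, map_zero, sub_zero, inner_sub_left]
  linarith

theorem inner_curvatureAt_antisymm (hmetric : cov.IsMetricCompatible)
    (u v w z : TangentSpace (𝓡 3) x) :
    inner ℝ (curvatureAt cov x u v w) z = - inner ℝ (curvatureAt cov x u v z) w := by
  have h := inner_curvatureAt_self hmetric u v (w + z)
  rw [curvatureAt_add_right] at h
  simp only [inner_add_left, inner_add_right, inner_curvatureAt_self hmetric] at h
  linarith

/-- For coordinate fields A, B vanishing torsion means ∇_A B = ∇_B A near x, so the six second
derivatives in the cyclic sum cancel in pairs. -/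
theorem curvatureAt_cyclic_sum (htor : cov.torsion = 0) (u v w : TangentSpace (𝓡 3) x) :
    curvatureAt cov x u v w + curvatureAt cov x v w u + curvatureAt cov x w u v = 0 := by
  obtain ⟨a, rfl⟩ := exists_coordField_chartAt_eq x u
  obtain ⟨b, rfl⟩ := exists_coordField_chartAt_eq x v
  obtain ⟨c, rfl⟩ := exists_coordField_chartAt_eq x w
  have hc := fun c => smoothFieldNear_coordField_chartAt x c
  rw [← curvatureField_eq_curvatureAt cov (hc a) (hc b) (hc c),
    ← curvatureField_eq_curvatureAt cov (hc b) (hc c) (hc a),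
    ← curvatureField_eq_curvatureAt cov (hc c) (hc a) (hc b)]
  have hcomm : ∀ a b : E3, ∀ᶠ y in 𝓝 x,
      cov (coordField (chartAt E3 x) a) y (coordField (chartAt E3 x) b y) =
      cov (coordField (chartAt E3 x) b) y (coordField (chartAt E3 x) a y) := by
    intro a b
    filter_upwards [(chartAt E3 x).open_source.mem_nhds (mem_chart_source E3 x),
      (hc a).eventually, (hc b).eventually] with y hy ha hb
    have h := cov.torsion_eq_zero_iff.1 htor ha.mdiff hb.mdiff
    rw [mlieBracket_coordField contMDiffOn_chart hy, sub_eq_zero] at h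
    exact h.symm
  have h : ∀ a b c, cov (fun y => cov (coordField (chartAt E3 x) a) y
      (coordField (chartAt E3 x) b y)) x (coordField (chartAt E3 x) c x) =
    cov (fun y => cov (coordField (chartAt E3 x) b) y
      (coordField (chartAt E3 x) a y)) x (coordField (chartAt E3 x) c x) := fun a b c => by
    rw [((hc b).covDeriv cov (hc a)).cov_congr cov (hcomm a b)]
  simp only [curvatureField, mlieBracket_coordField_chartAt, map_zero, sub_zero]
  rw [h c b a, h c a b, h b a c]
  abel

theorem inner_curvatureAt_pair_symm (hmetric : cov.IsMetricCompatible) (htor : cov.torsion = 0)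
    (u v w z : TangentSpace (𝓡 3) x) :
    inner ℝ (curvatureAt cov x u v w) z = inner ℝ (curvatureAt cov x w z u) v := by
  have hb : ∀ u v w z : TangentSpace (𝓡 3) x, inner ℝ (curvatureAt cov x u v w) z +
      inner ℝ (curvatureAt cov x v w u) z + inner ℝ (curvatureAt cov x w u v) z = 0 := by
    intro u v w z
    rw [← inner_add_left, ← inner_add_left, curvatureAt_cyclic_sum htor, inner_zero_left]
  have hs : ∀ u v w z : TangentSpace (𝓡 3) x, inner ℝ (curvatureAt cov x u v w) z =
      - inner ℝ (curvatureAt cov x v u w) z := by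
    intro u v w z
    rw [curvatureAt_swap, inner_neg_left]
  have ha := fun u v w z : TangentSpace (𝓡 3) x => inner_curvatureAt_antisymm hmetric u v w z
  -- The classical argument: combine the four cyclic identities that omit one vector each from the
  -- cyclic positions, using skew-symmetry in each pair.
  linarith [hb u v w z, hb v w z u, hb w z u v, hb z u v w, hs u v w z, ha u v w z,
    hs v w u z, ha v w u z, hs w u v z, ha w u v z, hs v w z u, hs w z v u, ha w z v u, hs z v w u,
    ha z v w u, hs w z u v, ha w z u v, hs z u w v, ha z u w v, hs u w z v, ha u w z v,
    hs z u v w, ha z u v w, hs u v z w, ha u v z w, hs v z u w, ha v z u w, ha v w z u,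
    ha z u v w]

/-- In a manifold of constant sectional curvature, `R(u,v)n` is orthogonal to the plane of `u` and
`v` if `n` is. -/
theorem inner_curvatureAt_of_sectionalCurvature (hmetric : cov.IsMetricCompatible)
    (htor : cov.torsion = 0) {κ : ℝ}
    (hκ : ∀ u v : TangentSpace (𝓡 3) x, LinearIndependent ℝ ![u, v] →
        sectionalCurvature cov x u v = κ)
    {u v n : TangentSpace (𝓡 3) x} (hu : u ≠ 0) (hv : v ≠ 0) (hn : n ≠ 0)
    (huv : inner ℝ u v = 0) (hun : inner ℝ u n = 0) (hvn : inner ℝ v n = 0) :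
    inner ℝ (curvatureAt cov x u v n) u = 0 := by
  have key : ∀ w : TangentSpace (𝓡 3) x, w ≠ 0 → inner ℝ w u = 0 →
      inner ℝ (curvatureAt cov x w u u) w = κ * (inner ℝ w w * inner ℝ u u) := by
    intro w hw hwu
    have hli : LinearIndependent ℝ ![w, u] := by
      refine linearIndependent_of_ne_zero_of_inner_eq_zero (𝕜 := ℝ) ?_ ?_
      · intro i
        fin_cases i <;> simp [hw, hu]
      · intro i j hij
        fin_cases i <;> fin_cases j <;> simp [hwu, real_inner_comm w] at hij ⊢
    have h := hκ w u hli
    have h1 : inner ℝ w w ≠ 0 := inner_self_ne_zero.2 hw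
    have h2 : inner ℝ u u ≠ 0 := inner_self_ne_zero.2 hu
    rw [sectionalCurvature, hwu, div_eq_iff (by simp [hw, hu])] at h
    rw [h]
    ring
  have hvn0 : v + n ≠ 0 := by
    intro h
    have : inner ℝ v (v + n) = 0 := by rw [h, inner_zero_right]
    rw [inner_add_right, hvn, add_zero] at this
    exact hv (inner_self_eq_zero.1 this)
  have hvu : inner ℝ v u = 0 := by rw [real_inner_comm, huv]
  have hnu : inner ℝ n u = 0 := by rw [real_inner_comm, hun]
  have hnv : inner ℝ n v = 0 := by rw [real_inner_comm, hvn]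
  -- Polarization: subtracting the curvatures of the planes (v, u) and (n, u) from that of (v + n,
  -- u) leaves ⟨R(v,u)u, n⟩ + ⟨R(n,u)u, v⟩ = 0. Pair symmetry makes the two terms equal.
  have h := key (v + n) hvn0 (by rw [inner_add_left, hvu, hnu, add_zero])
  simp only [curvatureAt_add_left, inner_add_left, inner_add_right, key v hv hvu, key n hn hnu,
    hvn, hnv] at h
  have h1 := inner_curvatureAt_pair_symm hmetric htor n u u v
  have h2 := inner_curvatureAt_antisymm hmetric u v n u
  have h3 : inner ℝ (curvatureAt cov x u v u) n = - inner ℝ (curvatureAt cov x v u u) n := by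
    rw [curvatureAt_swap, inner_neg_left]
  linarith

/-- In an Einstein 3-manifold, `R(u,v)n` is orthogonal to the plane of `u` and `v` if `n` is. -/
theorem inner_curvatureAt_of_ricci (hmetric : cov.IsMetricCompatible) {r : ℝ}
    (hr : ∀ u v : TangentSpace (𝓡 3) x, ricci cov x u v = r * inner ℝ u v)
    {u v n : TangentSpace (𝓡 3) x} (hu : u ≠ 0) (hv : v ≠ 0) (hn : n ≠ 0)
    (huv : inner ℝ u v = 0) (hun : inner ℝ u n = 0) (hvn : inner ℝ v n = 0) :
    inner ℝ (curvatureAt cov x u v n) u = 0 := by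
  have hvu : inner ℝ v u = 0 := by rw [real_inner_comm, huv]
  have hnu : inner ℝ n u = 0 := by rw [real_inner_comm, hun]
  have hnv : inner ℝ n v = 0 := by rw [real_inner_comm, hvn]
  let L : TangentSpace (𝓡 3) x →ₗ[ℝ] TangentSpace (𝓡 3) x :=
    { toFun := fun w => curvatureAt cov x w v n
      map_add' := fun w w' => curvatureAt_add_left cov w w' v n
      map_smul' := fun c w => curvatureAt_smul_left cov w v n c }
  -- The trace of w ↦ R(w,v)n is Ric(v,n) = r⟨v,n⟩ = 0.
  have h1 : LinearMap.trace ℝ _ L = 0 := by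
    rw [L.trace_eq_sum_inner (stdOrthonormalBasis ℝ (TangentSpace (𝓡 3) x))]
    have := hr v n
    rw [hvn, mul_zero, ricci] at this
    rw [← this]
    exact Finset.sum_congr rfl fun i _ => real_inner_comm _ _
  -- In this frame the v-term of the trace vanishes because R(v,v) = 0 and the n-term because
  -- ⟨R(n,v)n, n⟩ = 0, so the u-term vanishes too.
  let e : Fin 3 → TangentSpace (𝓡 3) x := ![‖u‖⁻¹ • u, ‖v‖⁻¹ • v, ‖n‖⁻¹ • n]
  have he : Orthonormal ℝ e := by
    constructor
    · intro i
      fin_cases i <;> simp [e, norm_smul, hu, hv, hn]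
    · intro i j hij
      fin_cases i <;> fin_cases j <;>
        simp [e, inner_smul_left, inner_smul_right, huv, hvu, hun, hnu, hvn, hnv] at hij ⊢
  have hcard : Fintype.card (Fin 3) = finrank ℝ (TangentSpace (𝓡 3) x) := by
    rw [(factFinrankTangent x).out, Fintype.card_fin]
  let B := (basisOfOrthonormalOfCardEqFinrank he hcard).toOrthonormalBasis (by simpa using he)
  have hB : ∀ i, B i = e i := fun i => by simp [B]
  rw [L.trace_eq_sum_inner B, Fin.sum_univ_three, hB, hB, hB] at h1
  have h0 : curvatureAt cov x v v n = 0 := by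
    have := curvatureAt_swap cov v v n
    have h2 : (2 : ℝ) • curvatureAt cov x v v n = 0 := by
      rw [two_smul]
      nth_rw 1 [this]
      exact neg_add_cancel _
    simpa using h2
  have h2 : inner ℝ n (curvatureAt cov x n v n) = 0 := by
    rw [real_inner_comm, inner_curvatureAt_self hmetric]
  simp only [e, Matrix.cons_val, map_smul, inner_smul_left, inner_smul_right, L, LinearMap.coe_mk,
    AddHom.coe_mk, h0, h2, inner_zero_right] at h1
  rw [real_inner_comm]
  simpa [hu] using h1

end MetricCurvature

/-! ### Charts straightening the surface, and commuting extensions of its coordinate fields. -/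

section AdaptedFields

open VectorField

variable {M : Type*} [TopologicalSpace M] [ChartedSpace E3 M] [IsManifold (𝓡 3) ∞ M]
  {S : Type*} [TopologicalSpace S] [ChartedSpace E2 S] [IsManifold (𝓡 2) ∞ S]

/-- A chart of `M` that straightens an immersed surface and extends a given chart of it. -/
theorem exists_slice_chart {f : S → M} {p : S} (hf : IsImmersionAt (𝓡 2) (𝓡 3) ∞ f p)
    {z : OpenPartialHomeomorph S ℂ} (hz : ContMDiffOn (𝓡 2) 𝓘(ℝ, ℂ) ∞ z z.source)
    (hz' : ContMDiffOn 𝓘(ℝ, ℂ) (𝓡 2) ∞ z.symm z.target) (hp : p ∈ z.source) :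
    ∃ (K : Type) (_ : NormedAddCommGroup K) (_ : NormedSpace ℝ K) (_ : CompleteSpace K)
      (C : OpenPartialHomeomorph M (ℂ × K)),
      ContMDiffOn (𝓡 3) 𝓘(ℝ, ℂ × K) ∞ C C.source ∧
      ContMDiffOn 𝓘(ℝ, ℂ × K) (𝓡 3) ∞ C.symm C.target ∧
      f p ∈ C.source ∧ ∀ᶠ q in 𝓝 p, C (f q) = (z q, 0) := by
  let K := hf.complement
  let e : (E2 × K) ≃L[ℝ] E3 := hf.equiv
  have : FiniteDimensional ℝ K := FiniteDimensional.of_injective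
    (e.toLinearMap ∘ₗ LinearMap.inr ℝ E2 K) (e.injective.comp LinearMap.inr_injective)
  have : CompleteSpace K := FiniteDimensional.complete ℝ K
  have heq : ∀ q ∈ hf.domChart.source, hf.codChart (f q) = e (hf.domChart q, 0) := by
    intro q hq
    have := hf.writtenInCharts (show hf.domChart q ∈ (hf.domChart.extend (𝓡 2)).target by
      simpa using hf.domChart.map_source hq)
    simpa [hf.domChart.left_inv hq] using this
  -- In the charts of the immersion the map is q ↦ (q, 0) up to the linear equivalence `e`. Applying
  -- this transition map to the first factor turns the surface coordinates into those of `z`.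
  let T : OpenPartialHomeomorph E2 ℂ := hf.domChart.symm.trans z
  let L : OpenPartialHomeomorph E3 (E2 × K) := e.symm.toHomeomorph.toOpenPartialHomeomorph
  let P : OpenPartialHomeomorph (E2 × K) (ℂ × K) := T.prod (.refl K)
  have hT : ContDiffOn ℝ ∞ T T.source := by
    rw [← contMDiffOn_iff_contDiffOn]
    refine (hz.comp (t := z.source)
      ((contMDiffOn_symm_of_mem_maximalAtlas hf.domChart_mem_maximalAtlas).mono ?_) ?_)
    · intro w hw
      simp only [T, mfld_simps] at hw
      exact hw.1
    · intro w hw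
      simp only [T, mfld_simps] at hw
      exact hw.2
  have hT' : ContDiffOn ℝ ∞ T.symm T.target := by
    rw [← contMDiffOn_iff_contDiffOn]
    refine ((contMDiffOn_of_mem_maximalAtlas hf.domChart_mem_maximalAtlas).comp
      (t := hf.domChart.source) (hz'.mono ?_) ?_)
    · intro w hw
      simp only [T, mfld_simps] at hw
      exact hw.1
    · intro w hw
      simp only [T, mfld_simps] at hw
      exact hw.2
  have hP : ContDiffOn ℝ ∞ P P.source := by
    refine ContDiffOn.prodMk (hT.comp contDiff_fst.contDiffOn ?_) contDiff_snd.contDiffOn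
    intro w hw
    simp only [P, mfld_simps] at hw
    exact hw
  have hP' : ContDiffOn ℝ ∞ P.symm P.target := by
    refine ContDiffOn.prodMk (hT'.comp contDiff_fst.contDiffOn ?_) contDiff_snd.contDiffOn
    intro w hw
    simp only [P, mfld_simps] at hw
    exact hw
  refine ⟨K, inferInstance, inferInstance, inferInstance, (hf.codChart.trans L).trans P,
    ?_, ?_, ?_, ?_⟩
  · have h1 := contMDiffOn_of_mem_maximalAtlas hf.codChart_mem_maximalAtlas
    have h2 : ContMDiff (𝓡 3) 𝓘(ℝ, E2 × K) ∞ L := e.symm.contDiff.contMDiff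
    refine (contMDiffOn_iff_contDiffOn.2 hP).comp (t := P.source)
      ((h2.comp_contMDiffOn h1).mono ?_) ?_
    · intro w hw
      simp only [mfld_simps] at hw
      exact hw.1.1
    · intro w hw
      simp only [mfld_simps] at hw
      exact hw.2
  · have h1 := contMDiffOn_symm_of_mem_maximalAtlas hf.codChart_mem_maximalAtlas
    have h2 : ContMDiff 𝓘(ℝ, E2 × K) (𝓡 3) ∞ L.symm := e.contDiff.contMDiff
    refine h1.comp (t := hf.codChart.target) ((h2.comp_contMDiffOn
      (contMDiffOn_iff_contDiffOn.2 hP')).mono ?_) ?_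
    · intro w hw
      simp only [mfld_simps] at hw
      exact hw.1
    · intro w hw
      simp only [mfld_simps] at hw
      exact hw.2.2
  · have h1 := hf.mem_codChart_source
    have h2 := heq p hf.mem_domChart_source
    have h3 : L (hf.codChart (f p)) = (hf.domChart p, 0) := by
      rw [h2]
      exact e.symm_apply_apply _
    refine ⟨⟨h1, trivial⟩, ?_⟩
    change L (hf.codChart (f p)) ∈ P.source
    rw [h3]
    simp [P, T, hf.domChart.map_source hf.mem_domChart_source,
      hf.domChart.left_inv hf.mem_domChart_source, hp]
  · filter_upwards [hf.domChart.open_source.mem_nhds hf.mem_domChart_source] with q hq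
    have h2 := heq q hq
    have h3 : L (hf.codChart (f q)) = (hf.domChart q, 0) := by
      rw [h2]
      exact e.symm_apply_apply _
    simp only [OpenPartialHomeomorph.coe_trans, Function.comp_apply, h3]
    simp [P, T, hf.domChart.left_inv hq]

variable [RiemannianBundle (fun x : M => TangentSpace (𝓡 3) x)]

namespace OrientedSurface

variable (F : OrientedSurface M S) {z : OpenPartialHomeomorph S ℂ}

theorem contMDiff_emb : ContMDiff (𝓡 2) (𝓡 3) ∞ F.emb := F.isSmoothEmbedding.contMDiff

theorem mdiff_emb (p : S) : MDifferentiableAt (𝓡 2) (𝓡 3) F.emb p :=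
  F.contMDiff_emb.contMDiffAt.mdifferentiableAt (by simp)

theorem eventually_emb {p : S} {P : M → Prop} (h : ∀ᶠ x in 𝓝 (F.emb p), P x) :
    ∀ᶠ q in 𝓝 p, P (F.emb q) :=
  F.contMDiff_emb.continuous.continuousAt.eventually h

theorem coordVec_mem (p : S) (a : ℂ) : F.coordVec z p a ∈ F.tangentPlane p :=
  LinearMap.mem_range_self _ _

theorem mdiff_emb_symm (hz' : ContMDiffOn 𝓘(ℝ, ℂ) (𝓡 2) ∞ z.symm z.target) {p : S}
    (hp : p ∈ z.source) : MDifferentiableAt 𝓘(ℝ, ℂ) (𝓡 3) (F.emb ∘ z.symm) (z p) :=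
  (F.mdiff_emb _).comp (z p)
    ((hz'.contMDiffAt (z.open_target.mem_nhds (z.map_source hp))).mdifferentiableAt (by simp))

theorem mfderiv_comp_emb_symm (hz' : ContMDiffOn 𝓘(ℝ, ℂ) (𝓡 2) ∞ z.symm z.target) {p : S}
    (hp : p ∈ z.source) (a : ℂ) :
    mfderiv 𝓘(ℝ, ℂ) (𝓡 3) (F.emb ∘ z.symm) (z p) a = F.coordVec z p a := by
  have h := mfderiv_comp_of_eq (I := 𝓘(ℝ, ℂ)) (x := z p) (F.mdiff_emb p)
    ((hz'.contMDiffAt (z.open_target.mem_nhds (z.map_source hp))).mdifferentiableAt (by simp))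
    (z.left_inv hp)
  have h3 := DFunLike.congr_fun h a
  rw [z.left_inv hp] at h3
  exact h3

theorem coordVec_eq (p : S) (a : ℂ) :
    F.coordVec z p a = a.re • F.coordVec z p 1 + a.im • F.coordVec z p Complex.I := by
  let A : ℂ →L[ℝ] E2 := mfderiv 𝓘(ℝ, ℂ) (𝓡 2) z.symm (z p)
  let B : E2 →L[ℝ] E3 := mfderiv (𝓡 2) (𝓡 3) F.emb p
  change B (A a) = a.re • B (A 1) + a.im • B (A Complex.I)
  rw [← map_smul, ← map_smul, ← map_smul, ← map_smul, ← map_add, ← map_add]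
  congr 2
  apply Complex.ext <;> simp

theorem exists_eq_of_mem_tangentPlane (hz : ContMDiffOn (𝓡 2) 𝓘(ℝ, ℂ) ∞ z z.source)
    (hz' : ContMDiffOn 𝓘(ℝ, ℂ) (𝓡 2) ∞ z.symm z.target) {p : S} (hp : p ∈ z.source)
    {v : TangentSpace (𝓡 3) (F.emb p)} (hv : v ∈ F.tangentPlane p) :
    ∃ a b : ℝ, v = a • F.coordVec z p 1 + b • F.coordVec z p Complex.I := by
  obtain ⟨u, rfl⟩ := hv
  have h := mfderiv_comp_of_eq (I := 𝓡 2) (x := p)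
    ((hz'.contMDiffAt (z.open_target.mem_nhds (z.map_source hp))).mdifferentiableAt (by simp))
    ((hz.contMDiffAt (z.open_source.mem_nhds hp)).mdifferentiableAt (by simp)) rfl
  have h2 : mfderiv (𝓡 2) (𝓡 2) (z.symm ∘ z) p = ContinuousLinearMap.id ℝ _ := by
    rw [← mfderiv_id]
    exact Filter.EventuallyEq.mfderiv_eq (z.eventually_left_inverse hp)
  rw [h2] at h
  have h3 := DFunLike.congr_fun h u
  let a : ℂ := mfderiv (𝓡 2) 𝓘(ℝ, ℂ) z p u
  refine ⟨a.re, a.im, ?_⟩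
  rw [← coordVec_eq]
  exact congrArg (mfderiv (𝓡 2) (𝓡 3) F.emb p) h3

/-- In a straightening chart C, the map C ∘ emb ∘ z⁻¹ is w ↦ (w, 0), so the coordinate fields of C
in the directions (1, 0) and (i, 0) restrict to ∂/∂x and ∂/∂y on the surface; as coordinate fields
they commute. -/
theorem exists_adapted_fields (hz : ContMDiffOn (𝓡 2) 𝓘(ℝ, ℂ) ∞ z z.source)
    (hz' : ContMDiffOn 𝓘(ℝ, ℂ) (𝓡 2) ∞ z.symm z.target) {p : S} (hp : p ∈ z.source) :
    ∃ e₁ e₂ : Π x : M, TangentSpace (𝓡 3) x, SmoothFieldNear e₁ (F.emb p) ∧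
      SmoothFieldNear e₂ (F.emb p) ∧ (∀ᶠ x in 𝓝 (F.emb p), mlieBracket (𝓡 3) e₁ e₂ x = 0) ∧
      ∀ᶠ q in 𝓝 p, e₁ (F.emb q) = F.coordVec z q 1 ∧ e₂ (F.emb q) = F.coordVec z q Complex.I := by
  obtain ⟨K, _, _, _, C, hC, hC', hpC, hCz⟩ := exists_slice_chart
    (F.isSmoothEmbedding.isImmersion.isImmersionAt p) hz hz' hp
  refine ⟨coordField C (1, 0), coordField C (Complex.I, 0), .coordField hC hC' hpC _,
    .coordField hC hC' hpC _, ?_, ?_⟩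
  · filter_upwards [C.open_source.mem_nhds hpC] with x hx using mlieBracket_coordField hC hx _ _
  have key : ∀ᶠ q in 𝓝 p, ∀ a : ℂ, coordField C (a, 0) (F.emb q) = F.coordVec z q a := by
    filter_upwards [z.open_source.mem_nhds hp, F.eventually_emb (C.open_source.mem_nhds hpC),
      eventually_eventually_nhds.2 hCz] with q hq hqC hCq a
    refine coordField_eq_of_mfderiv hC hC' hqC ?_
    rw [← F.mfderiv_comp_emb_symm hz' hq]
    have h := mfderiv_comp_of_eq (I := 𝓘(ℝ, ℂ)) (x := z q) (mdiff_chart hC hqC)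
      (F.mdiff_emb_symm hz' hq) (by simp [z.left_inv hq])
    have h2 : mfderiv 𝓘(ℝ, ℂ) 𝓘(ℝ, ℂ × K) (C ∘ F.emb ∘ z.symm) (z q) =
        ContinuousLinearMap.inl ℝ ℂ K := by
      rw [mfderiv_eq_fderiv, ← (ContinuousLinearMap.inl ℝ ℂ K).fderiv (x := z q)]
      refine Filter.EventuallyEq.fderiv_eq ?_
      have := (z.symm.continuousAt (z.map_source hq)).eventually
        (by rw [z.left_inv hq]; exact hCq)
      filter_upwards [this, z.eventually_right_inverse (z.map_source hq)] with w h1 h2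
      simp [h1, h2]
    rw [h2] at h
    have h3 := DFunLike.congr_fun h a
    have aux : ∀ r, r = F.emb q → ∀ v : E3,
        (mfderiv (𝓡 3) 𝓘(ℝ, ℂ × K) C (F.emb q) : E3 →L[ℝ] ℂ × K) v =
          (mfderiv (𝓡 3) 𝓘(ℝ, ℂ × K) C r : E3 →L[ℝ] ℂ × K) v := by
      rintro _ rfl v
      rfl
    exact (aux _ (congrArg F.emb (z.left_inv hq)) _).trans h3.symm
  exact key.mono fun q hq => ⟨hq _, hq _⟩

end OrientedSurface

end AdaptedFields

/-! ### Traces and inner products of 2-forms in a conformal basis of a plane. -/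

section LinearAlgebra

variable {V : Type*} [NormedAddCommGroup V] [InnerProductSpace ℝ V]

theorem eq_zero_of_inner_eq_zero_of_finrank_eq_three [h3 : Fact (finrank ℝ V = 3)] {a b c w : V}
    (ha : a ≠ 0) (hb : b ≠ 0) (hc : c ≠ 0) (hab : inner ℝ a b = 0) (hac : inner ℝ a c = 0)
    (hbc : inner ℝ b c = 0) (hwa : inner ℝ w a = 0) (hwb : inner ℝ w b = 0)
    (hwc : inner ℝ w c = 0) : w = 0 := by
  have : FiniteDimensional ℝ V := .of_fact_finrank_eq_succ 2
  by_contra hw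
  have hli : LinearIndependent ℝ ![a, b, c, w] := by
    refine linearIndependent_of_ne_zero_of_inner_eq_zero (𝕜 := ℝ) ?_ ?_
    · intro i
      fin_cases i <;> simp [ha, hb, hc, hw]
    · intro i j hij
      fin_cases i <;> fin_cases j <;>
        simp [hab, hac, hbc, hwa, hwb, hwc, real_inner_comm a b, real_inner_comm a c,
          real_inner_comm b c, real_inner_comm w a, real_inner_comm w b,
          real_inner_comm w c] at hij ⊢
  have := hli.fintype_card_le_finrank
  rw [h3.out] at this
  simp at this

/-- The coordinates of an orthonormal basis of a plane with respect to a conformal basis. -/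
theorem exists_coordinates_of_conformal_basis {P : Submodule ℝ V} {X₁ X₂ : V} {g : ℝ} (hg : g ≠ 0)
    (h₁ : X₁ ∈ P) (h₂ : X₂ ∈ P) (hP : ∀ v ∈ P, ∃ a b : ℝ, v = a • X₁ + b • X₂)
    (h11 : inner ℝ X₁ X₁ = g) (h22 : inner ℝ X₂ X₂ = g) (h12 : inner ℝ X₁ X₂ = 0)
    {ι : Type*} [Fintype ι] (E : OrthonormalBasis ι ℝ P) :
    ∃ a b : ι → ℝ, (∀ i, (E i : V) = a i • X₁ + b i • X₂) ∧ ∑ i, a i * a i = 1 / g ∧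
      ∑ i, b i * b i = 1 / g ∧ ∑ i, a i * b i = 0 := by
  choose a b hab using fun i => hP (E i) (E i).2
  have h21 : inner ℝ X₂ X₁ = 0 := by rw [real_inner_comm, h12]
  have ha : ∀ i, inner ℝ (E i : V) X₁ = a i * g := fun i => by
    rw [hab, inner_add_left, inner_smul_left, inner_smul_left, h11, h21]
    simp
  have hb : ∀ i, inner ℝ (E i : V) X₂ = b i * g := fun i => by
    rw [hab, inner_add_left, inner_smul_left, inner_smul_left, h12, h22]
    simp
  -- Parseval's identity for the pairs of X₁, X₂ gives the three sums multiplied by g².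
  have e11 := E.sum_inner_mul_inner ⟨X₁, h₁⟩ ⟨X₁, h₁⟩
  have e22 := E.sum_inner_mul_inner ⟨X₂, h₂⟩ ⟨X₂, h₂⟩
  have e12 := E.sum_inner_mul_inner ⟨X₁, h₁⟩ ⟨X₂, h₂⟩
  simp only [Submodule.coe_inner, h11, h22, h12, real_inner_comm (E _ : V) X₁,
    real_inner_comm (E _ : V) X₂, ha, hb] at e11 e22 e12
  have key : ∀ c d : ι → ℝ, ∑ i, c i * g * (d i * g) = (g * g) * ∑ i, c i * d i := by
    intro c d
    rw [Finset.mul_sum]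
    exact Finset.sum_congr rfl fun i _ => by ring
  rw [key] at e11 e22 e12
  refine ⟨a, b, hab, ?_, ?_, ?_⟩
  · rw [eq_div_iff hg]
    apply mul_left_cancel₀ hg
    linarith
  · rw [eq_div_iff hg]
    apply mul_left_cancel₀ hg
    linarith
  · exact (mul_eq_zero.1 e12).resolve_left (mul_ne_zero hg hg)

/-- The cross terms carry the factor ∑ aᵢ bᵢ = 0, so B need not be symmetric, as is required for II
in the presence of torsion. -/
theorem sum_bilin_of_coordinates {ι : Type*} [Fintype ι] {E : ι → V} {a b : ι → ℝ} {X₁ X₂ : V}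
    {g : ℝ} (hE : ∀ i, E i = a i • X₁ + b i • X₂) (haa : ∑ i, a i * a i = 1 / g)
    (hbb : ∑ i, b i * b i = 1 / g) (hab : ∑ i, a i * b i = 0) (B : V →ₗ[ℝ] V →ₗ[ℝ] ℝ) :
    ∑ i, B (E i) (E i) = (B X₁ X₁ + B X₂ X₂) / g := by
  have : ∀ i, B (E i) (E i) = (a i * a i) * B X₁ X₁ + (b i * b i) * B X₂ X₂ +
      (a i * b i) * (B X₁ X₂ + B X₂ X₁) := by
    intro i
    rw [hE]
    simp
    ring
  simp only [this, Finset.sum_add_distrib, ← Finset.sum_mul, haa, hbb, hab]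
  ring

/-- Each form contributes the minor aᵢ bⱼ - bᵢ aⱼ, and by Lagrange's identity the squares of the
minors add up to 2 / g². -/
theorem sum_alternating_of_coordinates {ι : Type*} [Fintype ι] {E : ι → V} {a b : ι → ℝ}
    {X₁ X₂ : V} {g : ℝ} (hE : ∀ i, E i = a i • X₁ + b i • X₂) (haa : ∑ i, a i * a i = 1 / g)
    (hbb : ∑ i, b i * b i = 1 / g) (hab : ∑ i, a i * b i = 0) (B C : V →ₗ[ℝ] V →ₗ[ℝ] ℝ)
    (hB : B.IsAlt) (hC : C.IsAlt) :
    ∑ i, ∑ j, B (E i) (E j) * C (E i) (E j) = 2 * (B X₁ X₂ * C X₁ X₂) / g ^ 2 := by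
  have alt : ∀ D : V →ₗ[ℝ] V →ₗ[ℝ] ℝ, D.IsAlt → ∀ i j, D (E i) (E j) =
      (a i * b j - b i * a j) * D X₁ X₂ := by
    intro D hD i j
    have h : D X₂ X₁ = - D X₁ X₂ := by rw [← hD.neg X₁ X₂]
    rw [hE, hE]
    simp [hD.self_eq_zero, h]
    ring
  have : ∀ i j, B (E i) (E j) * C (E i) (E j) = ((a i * a i) * (b j * b j) +
      (b i * b i) * (a j * a j) - 2 * ((a i * b i) * (a j * b j))) * (B X₁ X₂ * C X₁ X₂) := by
    intro i j
    rw [alt B hB, alt C hC]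
    ring
  simp only [this, ← Finset.sum_mul, Finset.sum_add_distrib, Finset.sum_sub_distrib,
    ← Finset.mul_sum, haa, hbb, hab]
  ring

end LinearAlgebra

/-! ### Extension of the normal field; II, H and ⋆τ in a complex chart. -/

section NormalExtension

open VectorField

variable {M : Type*} [TopologicalSpace M] [ChartedSpace E3 M] [IsManifold (𝓡 3) ∞ M]
  [RiemannianBundle (fun x : M => TangentSpace (𝓡 3) x)]
  [IsContMDiffRiemannianBundle (𝓡 3) ∞ E3 (fun x : M => TangentSpace (𝓡 3) x)]
  {S : Type*} [TopologicalSpace S] [ChartedSpace E2 S] [IsManifold (𝓡 2) ∞ S]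

namespace OrientedSurface

variable (F : OrientedSurface M S) {z : OpenPartialHomeomorph S ℂ} {o : ManifoldOrientation M}
  {cov : CovariantDerivative (𝓡 3) E3 (fun x : M => TangentSpace (𝓡 3) x)}

theorem inner_normal_of_mem {q : S} {u : TangentSpace (𝓡 3) (F.emb q)}
    (hu : u ∈ F.tangentPlane q) : inner ℝ (F.normal q) u = 0 := by
  obtain ⟨v, rfl⟩ := hu
  exact F.inner_normal q v

theorem normal_ne_zero (q : S) : F.normal q ≠ 0 := by
  rw [← norm_ne_zero_iff, F.norm_normal]
  exact one_ne_zero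

theorem fderiv_comp_emb_symm (hz' : ContMDiffOn 𝓘(ℝ, ℂ) (𝓡 2) ∞ z.symm z.target) {p : S}
    (hp : p ∈ z.source) {h : M → ℝ} (hh : MDifferentiableAt (𝓡 3) 𝓘(ℝ) h (F.emb p)) (a : ℂ) :
    fderiv ℝ (h ∘ F.emb ∘ z.symm) (z p) a = mvfderiv (𝓡 3) h (F.emb p) (F.coordVec z p a) := by
  have h1 := mfderiv_comp_of_eq (I := 𝓘(ℝ, ℂ)) (x := z p) hh
    (F.mdiff_emb_symm hz' hp) (by simp [z.left_inv hp])
  rw [mfderiv_eq_fderiv] at h1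
  have h3 := DFunLike.congr_fun h1 a
  have aux : ∀ r, r = F.emb p → ∀ v : E3,
      (mfderiv (𝓡 3) 𝓘(ℝ) h (F.emb p) : E3 →L[ℝ] ℝ) v =
        (mfderiv (𝓡 3) 𝓘(ℝ) h r : E3 →L[ℝ] ℝ) v := by
    rintro _ rfl v
    rfl
  rw [← F.mfderiv_comp_emb_symm hz' hp]
  exact h3.trans (aux _ (congrArg F.emb (z.left_inv hp)) _).symm

theorem differentiableAt_comp_emb_symm (hz' : ContMDiffOn 𝓘(ℝ, ℂ) (𝓡 2) ∞ z.symm z.target)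
    {p : S} (hp : p ∈ z.source) {h : M → ℝ}
    (hh : MDifferentiableAt (𝓡 3) 𝓘(ℝ) h (F.emb p)) :
    DifferentiableAt ℝ (h ∘ F.emb ∘ z.symm) (z p) :=
  (MDifferentiableAt.comp_of_eq (z p) hh (F.mdiff_emb_symm hz' hp)
    (by simp [z.left_inv hp])).differentiableAt

theorem eventually_comp_symm {p : S} (hp : p ∈ z.source) {P : S → Prop} (h : ∀ᶠ q in 𝓝 p, P q) :
    ∀ᶠ w in 𝓝 (z p), P (z.symm w) :=
  (z.symm.continuousAt (z.map_source hp)).eventually (by rw [z.left_inv hp]; exact h)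

/-- Identities such as |e₁|² = |e₂|² hold only along the surface; this lets them be differentiated
in tangential directions. -/
theorem mvfderiv_coordVec_eq (hz' : ContMDiffOn 𝓘(ℝ, ℂ) (𝓡 2) ∞ z.symm z.target) {p : S}
    (hp : p ∈ z.source) {h k : M → ℝ} (hh : MDifferentiableAt (𝓡 3) 𝓘(ℝ) h (F.emb p))
    (hk : MDifferentiableAt (𝓡 3) 𝓘(ℝ) k (F.emb p)) (h0 : ∀ᶠ q in 𝓝 p, h (F.emb q) = k (F.emb q))
    (a : ℂ) : mvfderiv (𝓡 3) h (F.emb p) (F.coordVec z p a) =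
      mvfderiv (𝓡 3) k (F.emb p) (F.coordVec z p a) := by
  rw [← F.fderiv_comp_emb_symm hz' hp hh, ← F.fderiv_comp_emb_symm hz' hp hk]
  congr 1
  exact Filter.EventuallyEq.fderiv_eq (eventually_comp_symm hp h0)

theorem mvfderiv_coordVec_eq_zero (hz' : ContMDiffOn 𝓘(ℝ, ℂ) (𝓡 2) ∞ z.symm z.target) {p : S}
    (hp : p ∈ z.source) {h : M → ℝ} (hh : MDifferentiableAt (𝓡 3) 𝓘(ℝ) h (F.emb p)) {c : ℝ}
    (h0 : ∀ᶠ q in 𝓝 p, h (F.emb q) = c) (a : ℂ) :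
    mvfderiv (𝓡 3) h (F.emb p) (F.coordVec z p a) = 0 := by
  rw [F.mvfderiv_coordVec_eq hz' hp hh mdifferentiableAt_const h0, mvfderiv_const]
  rfl

theorem exists_isTangentExtension (hz : ContMDiffOn (𝓡 2) 𝓘(ℝ, ℂ) ∞ z z.source)
    (hz' : ContMDiffOn 𝓘(ℝ, ℂ) (𝓡 2) ∞ z.symm z.target) {p : S} (hp : p ∈ z.source)
    {v : TangentSpace (𝓡 3) (F.emb p)} (hv : v ∈ F.tangentPlane p) :
    ∃ Y, F.IsTangentExtension p v Y := by
  obtain ⟨e₁, e₂, h1, h2, -, he⟩ := F.exists_adapted_fields hz hz' hp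
  obtain ⟨a, b, rfl⟩ := F.exists_eq_of_mem_tangentPlane hz hz' hp hv
  have hc : ∀ c : ℝ, SmoothFunNear (fun _ : M => c) (F.emb p) :=
    fun c => .of_forall fun _ => contMDiffAt_const
  refine ⟨fun x => a • e₁ x + b • e₂ x, ((SmoothFieldNear.smul (hc a) h1).add
    (SmoothFieldNear.smul (hc b) h2)).contMDiffAt, ?_, ?_⟩
  · simp only [he.self_of_nhds.1, he.self_of_nhds.2]
  · filter_upwards [he] with q hq
    rw [hq.1, hq.2]
    exact add_mem (Submodule.smul_mem _ _ (F.coordVec_mem q _))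
      (Submodule.smul_mem _ _ (F.coordVec_mem q _))

/-- The Weingarten equation, for an extension `ν` of the unit normal field. -/
theorem inner_normal_cov (hmetric : cov.IsMetricCompatible)
    (hz : ContMDiffOn (𝓡 2) 𝓘(ℝ, ℂ) ∞ z z.source)
    (hz' : ContMDiffOn 𝓘(ℝ, ℂ) (𝓡 2) ∞ z.symm z.target) {p : S} (hp : p ∈ z.source)
    {ν Y : Π x : M, TangentSpace (𝓡 3) x}
    (hν : MDifferentiableAt (𝓡 3) (𝓡 3).tangent
      (fun y => (⟨y, ν y⟩ : TangentBundle (𝓡 3) M)) (F.emb p))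
    (hνN : ∀ᶠ q in 𝓝 p, ν (F.emb q) = F.normal q)
    (hY : MDifferentiableAt (𝓡 3) (𝓡 3).tangent
      (fun y => (⟨y, Y y⟩ : TangentBundle (𝓡 3) M)) (F.emb p))
    (hYt : ∀ᶠ q in 𝓝 p, Y (F.emb q) ∈ F.tangentPlane q)
    {u : TangentSpace (𝓡 3) (F.emb p)} (hu : u ∈ F.tangentPlane p) :
    inner ℝ (F.normal p) (cov Y (F.emb p) u) = - inner ℝ (cov ν (F.emb p) u) (Y (F.emb p)) := by
  obtain ⟨a, b, rfl⟩ := F.exists_eq_of_mem_tangentPlane hz hz' hp hu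
  have key : ∀ c : ℂ, inner ℝ (F.normal p) (cov Y (F.emb p) (F.coordVec z p c)) =
      - inner ℝ (cov ν (F.emb p) (F.coordVec z p c)) (Y (F.emb p)) := by
    intro c
    have h1 := hmetric.mvfderiv_inner_eq (FiberBundle.extend E3 (F.coordVec z p c)) hν hY
    simp only [FiberBundle.extend_apply_self] at h1
    -- Along the surface ⟨ν, Y⟩ = 0, so its tangential derivative vanishes.
    rw [F.mvfderiv_coordVec_eq_zero hz' hp (hν.inner_bundle hY) (c := 0), hνN.self_of_nhds] at h1
    · linarith
    · filter_upwards [hνN, hYt] with q h1 h2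
      rw [h1, F.inner_normal_of_mem h2]
  simp only [map_add, map_smul, inner_add_left, inner_add_right, inner_smul_left,
    inner_smul_right, key]
  simp
  ring

/-- The right-hand side no longer involves the chosen tangent extension and is visibly bilinear,
which shows that `secondFundamentalForm` is a tensor on the tangent plane. -/
theorem secondFundamentalForm_eq (hmetric : cov.IsMetricCompatible)
    (hz : ContMDiffOn (𝓡 2) 𝓘(ℝ, ℂ) ∞ z z.source)
    (hz' : ContMDiffOn 𝓘(ℝ, ℂ) (𝓡 2) ∞ z.symm z.target) {p : S} (hp : p ∈ z.source)
    {ν : Π x : M, TangentSpace (𝓡 3) x}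
    (hν : MDifferentiableAt (𝓡 3) (𝓡 3).tangent
      (fun y => (⟨y, ν y⟩ : TangentBundle (𝓡 3) M)) (F.emb p))
    (hνN : ∀ᶠ q in 𝓝 p, ν (F.emb q) = F.normal q)
    {u v : TangentSpace (𝓡 3) (F.emb p)} (hu : u ∈ F.tangentPlane p)
    (hv : v ∈ F.tangentPlane p) :
    F.secondFundamentalForm cov p u v = - inner ℝ (cov ν (F.emb p) u) v := by
  obtain ⟨h1, h2, h3⟩ : F.IsTangentExtension p v (F.tangentExtension p v) :=
    Classical.epsilon_spec (F.exists_isTangentExtension hz hz' hp hv)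
  rw [secondFundamentalForm, F.inner_normal_cov hmetric hz hz' hp hν hνN
    (h1.mdifferentiableAt (by simp)) h3 hu, h2]

/-- The conformal factor of a complex chart. -/
def conformalFactor (F : OrientedSurface M S) (z : OpenPartialHomeomorph S ℂ) (p : S) : ℝ :=
  inner ℝ (F.coordVec z p 1) (F.coordVec z p 1)

namespace IsComplexChart

variable {F}

theorem smooth (hz : F.IsComplexChart o z) : ContMDiffOn (𝓡 2) 𝓘(ℝ, ℂ) ∞ z z.source := hz.1

theorem smooth_symm (hz : F.IsComplexChart o z) :
    ContMDiffOn 𝓘(ℝ, ℂ) (𝓡 2) ∞ z.symm z.target := hz.2.1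

theorem inner_coordVec (hz : F.IsComplexChart o z) {p : S} (hp : p ∈ z.source) :
    inner ℝ (F.coordVec z p 1) (F.coordVec z p Complex.I) = 0 := (hz.2.2 p hp).2.1

theorem inner_coordVec_I (hz : F.IsComplexChart o z) {p : S} (hp : p ∈ z.source) :
    inner ℝ (F.coordVec z p Complex.I) (F.coordVec z p Complex.I) = F.conformalFactor z p := by
  rw [conformalFactor, real_inner_self_eq_norm_sq, real_inner_self_eq_norm_sq, (hz.2.2 p hp).1]

theorem areaForm_pos (hz : F.IsComplexChart o z) {p : S} (hp : p ∈ z.source) :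
    0 < F.areaForm o p (F.coordVec z p 1) (F.coordVec z p Complex.I) := (hz.2.2 p hp).2.2

theorem coordVec_one_ne_zero (hz : F.IsComplexChart o z) {p : S} (hp : p ∈ z.source) :
    F.coordVec z p 1 ≠ 0 := by
  intro h
  have := hz.areaForm_pos hp
  rw [areaForm, h, ((o.at_ (F.emb p)).volumeForm.map_coord_zero (i := 1) (by simp))] at this
  exact lt_irrefl _ this

theorem conformalFactor_pos (hz : F.IsComplexChart o z) {p : S} (hp : p ∈ z.source) :
    0 < F.conformalFactor z p :=
  real_inner_self_pos.2 (hz.coordVec_one_ne_zero hp)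

theorem coordVec_I_ne_zero (hz : F.IsComplexChart o z) {p : S} (hp : p ∈ z.source) :
    F.coordVec z p Complex.I ≠ 0 := by
  intro h
  have := hz.inner_coordVec_I hp
  rw [h, inner_zero_left] at this
  exact (hz.conformalFactor_pos hp).ne this

/-- The volume of an orthogonal triple is, up to sign, the product of the norms; the chart being
oriented fixes the sign. -/
theorem areaForm_coordVec (hz : F.IsComplexChart o z) {p : S} (hp : p ∈ z.source) :
    F.areaForm o p (F.coordVec z p 1) (F.coordVec z p Complex.I) = F.conformalFactor z p := by
  have h := (o.at_ (F.emb p)).abs_volumeForm_apply_of_pairwise_orthogonal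
    (v := ![F.normal p, F.coordVec z p 1, F.coordVec z p Complex.I]) (by
      have h1 := F.inner_normal_of_mem (F.coordVec_mem (z := z) p 1)
      have h2 := F.inner_normal_of_mem (F.coordVec_mem (z := z) p Complex.I)
      have h3 := hz.inner_coordVec hp
      intro i j hij
      fin_cases i <;> fin_cases j <;> simp at hij ⊢ <;>
        first | assumption | (rw [real_inner_comm]; assumption))
  have h0 := hz.areaForm_pos hp
  rw [areaForm] at h0 ⊢
  rw [abs_of_pos h0, Fin.prod_univ_three] at h
  rw [h]
  simp only [Matrix.cons_val, F.norm_normal, ← (hz.2.2 p hp).1, conformalFactor,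
    real_inner_self_eq_norm_sq]
  ring

theorem eq_zero_of_inner (hz : F.IsComplexChart o z) {p : S} (hp : p ∈ z.source)
    {w : TangentSpace (𝓡 3) (F.emb p)} (h0 : inner ℝ w (F.normal p) = 0)
    (h1 : inner ℝ w (F.coordVec z p 1) = 0) (h2 : inner ℝ w (F.coordVec z p Complex.I) = 0) :
    w = 0 :=
  eq_zero_of_inner_eq_zero_of_finrank_eq_three (F.normal_ne_zero p) (hz.coordVec_one_ne_zero hp)
    (hz.coordVec_I_ne_zero hp) (F.inner_normal_of_mem (F.coordVec_mem p _))
    (F.inner_normal_of_mem (F.coordVec_mem p _)) (hz.inner_coordVec hp) h0 h1 h2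

/-- Gram-Schmidt: remove from an extension of the vector N(p) its components along e₁ and e₂ and
normalize. Along the surface the result is a unit normal, hence ±N, M having dimension 3. -/
theorem exists_normal_extension (hz : F.IsComplexChart o z) {p : S} (hp : p ∈ z.source) :
    ∃ ν : Π x : M, TangentSpace (𝓡 3) x, SmoothFieldNear ν (F.emb p) ∧
      ∀ᶠ q in 𝓝 p, ν (F.emb q) = F.normal q := by
  obtain ⟨e₁, e₂, h1, h2, -, he⟩ := F.exists_adapted_fields hz.smooth hz.smooth_symm hp
  have hep := he.self_of_nhds
  have h3 := SmoothFieldNear.extend (F.normal p)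
  have hn1 : inner ℝ (e₁ (F.emb p)) (e₁ (F.emb p)) ≠ 0 := by
    rw [hep.1]
    exact inner_self_ne_zero.2 (hz.coordVec_one_ne_zero hp)
  have hn2 : inner ℝ (e₂ (F.emb p)) (e₂ (F.emb p)) ≠ 0 := by
    rw [hep.2]
    exact inner_self_ne_zero.2 (hz.coordVec_I_ne_zero hp)
  let V : Π x : M, TangentSpace (𝓡 3) x := fun x => FiberBundle.extend E3 (F.normal p) x -
    (inner ℝ (FiberBundle.extend E3 (F.normal p) x) (e₁ x) *
      (inner ℝ (e₁ x) (e₁ x))⁻¹) • e₁ x -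
    (inner ℝ (FiberBundle.extend E3 (F.normal p) x) (e₂ x) *
      (inner ℝ (e₂ x) (e₂ x))⁻¹) • e₂ x
  have hV : SmoothFieldNear V (F.emb p) := (h3.sub
    (SmoothFieldNear.smul ((h3.inner h1).mul ((h1.inner h1).inv hn1)) h1)).sub
    (SmoothFieldNear.smul ((h3.inner h2).mul ((h2.inner h2).inv hn2)) h2)
  have hVp : V (F.emb p) = F.normal p := by
    simp only [V, FiberBundle.extend_apply_self, hep.1, hep.2,
      F.inner_normal_of_mem (F.coordVec_mem p _)]
    simp
  have hVV : inner ℝ (V (F.emb p)) (V (F.emb p)) = 1 := by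
    rw [hVp, real_inner_self_eq_norm_sq, F.norm_normal, one_pow]
  have hVV0 : inner ℝ (V (F.emb p)) (V (F.emb p)) ≠ 0 := by
    rw [hVV]; exact one_ne_zero
  have hsq : Real.sqrt (inner ℝ (V (F.emb p)) (V (F.emb p))) ≠ 0 := by
    rw [hVV, Real.sqrt_one]; exact one_ne_zero
  let ν : Π x : M, TangentSpace (𝓡 3) x := fun x => (Real.sqrt (inner ℝ (V x) (V x)))⁻¹ • V x
  have hν : SmoothFieldNear ν (F.emb p) :=
    SmoothFieldNear.smul (((hV.inner hV).sqrt hVV0).inv hsq) hV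
  -- ⟨ν, N⟩ is 1 at p, so by continuity it stays positive nearby, which excludes the sign -1.
  have hcont : ContinuousAt (fun q => inner ℝ (ν (F.emb q)) (F.normal q)) p := by
    have e1 : ContMDiffAt (𝓡 2) (𝓡 3).tangent ∞
        (fun q => (⟨F.emb q, ν (F.emb q)⟩ : TangentBundle (𝓡 3) M)) p :=
      hν.contMDiffAt.comp p F.contMDiff_emb.contMDiffAt
    exact (e1.inner_bundle F.contMDiff_normal.contMDiffAt).continuousAt
  have hpos : 0 < inner ℝ (ν (F.emb p)) (F.normal p) := by
    simp only [ν, hVp, Real.sqrt_one, inv_one, one_smul, real_inner_self_eq_norm_sq,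
      F.norm_normal, one_pow, zero_lt_one]
  refine ⟨ν, hν, ?_⟩
  filter_upwards [he, z.open_source.mem_nhds hp, hcont.eventually (lt_mem_nhds hpos),
    F.eventually_emb ((hV.inner hV).contMDiffAt.continuousAt.eventually_ne hVV0)] with
    q heq hq hcq hVq
  have i12 := hz.inner_coordVec hq
  have i21 : inner ℝ (F.coordVec z q Complex.I) (F.coordVec z q 1) = 0 := by
    rw [real_inner_comm, i12]
  have i11 : inner ℝ (F.coordVec z q 1) (F.coordVec z q 1) ≠ 0 :=
    inner_self_ne_zero.2 (hz.coordVec_one_ne_zero hq)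
  have i22 : inner ℝ (F.coordVec z q Complex.I) (F.coordVec z q Complex.I) ≠ 0 :=
    inner_self_ne_zero.2 (hz.coordVec_I_ne_zero hq)
  have o1 : inner ℝ (V (F.emb q)) (F.coordVec z q 1) = 0 := by
    simp only [V, heq.1, heq.2, inner_sub_left, inner_smul_left, i21, mul_zero, sub_zero,
      conj_trivial]
    rw [mul_assoc, inv_mul_cancel₀ i11, mul_one, sub_self]
  have o2 : inner ℝ (V (F.emb q)) (F.coordVec z q Complex.I) = 0 := by
    simp only [V, heq.1, heq.2, inner_sub_left, inner_smul_left, i12, mul_zero, sub_zero,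
      conj_trivial]
    rw [mul_assoc, inv_mul_cancel₀ i22, mul_one, sub_self]
  have hνn : ‖ν (F.emb q)‖ = 1 := by
    simp only [ν, norm_smul, ← norm_eq_sqrt_real_inner]
    have : ‖V (F.emb q)‖ ≠ 0 := by simpa using hVq
    simp [this]
  have n1 : inner ℝ (F.normal q) (F.coordVec z q 1) = 0 :=
    F.inner_normal_of_mem (F.coordVec_mem q _)
  have n2 : inner ℝ (F.normal q) (F.coordVec z q Complex.I) = 0 :=
    F.inner_normal_of_mem (F.coordVec_mem q _)
  have nn : inner ℝ (F.normal q) (F.normal q) = 1 := by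
    rw [real_inner_self_eq_norm_sq, F.norm_normal, one_pow]
  have h0 : ν (F.emb q) - inner ℝ (ν (F.emb q)) (F.normal q) • F.normal q = 0 := by
    refine hz.eq_zero_of_inner hq ?_ ?_ ?_
    · rw [inner_sub_left, real_inner_smul_left (F.normal q) (F.normal q), nn, mul_one, sub_self]
    · simp [inner_sub_left, inner_smul_left, n1, ν, o1]
    · simp [inner_sub_left, inner_smul_left, n2, ν, o2]
  rw [sub_eq_zero] at h0
  have h1 : |inner ℝ (ν (F.emb q)) (F.normal q)| = 1 := by
    rw [h0, norm_smul, F.norm_normal, mul_one, Real.norm_eq_abs] at hνn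
    exact hνn
  rw [abs_of_pos hcq] at h1
  rw [h0, h1, one_smul]

theorem meanCurvature_eq (hz : F.IsComplexChart o z) (hmetric : cov.IsMetricCompatible) {p : S}
    (hp : p ∈ z.source) : F.meanCurvature cov p =
      (F.secondFundamentalForm cov p (F.coordVec z p 1) (F.coordVec z p 1) +
        F.secondFundamentalForm cov p (F.coordVec z p Complex.I) (F.coordVec z p Complex.I)) /
        F.conformalFactor z p := by
  obtain ⟨ν, hν, hνN⟩ := hz.exists_normal_extension hp
  obtain ⟨a, b, hE, haa, hbb, hab⟩ := exists_coordinates_of_conformal_basis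
    (hz.conformalFactor_pos hp).ne' (F.coordVec_mem p 1) (F.coordVec_mem p Complex.I)
    (fun v hv => F.exists_eq_of_mem_tangentPlane hz.smooth hz.smooth_symm hp hv) rfl
    (hz.inner_coordVec_I hp) (hz.inner_coordVec hp) (stdOrthonormalBasis ℝ (F.tangentPlane p))
  let B : TangentSpace (𝓡 3) (F.emb p) →ₗ[ℝ] TangentSpace (𝓡 3) (F.emb p) →ₗ[ℝ] ℝ :=
    - (innerₗ _).comp (cov ν (F.emb p)).toLinearMap
  have hB : ∀ {u v}, u ∈ F.tangentPlane p → v ∈ F.tangentPlane p →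
      F.secondFundamentalForm cov p u v = B u v := fun hu hv =>
    F.secondFundamentalForm_eq hmetric hz.smooth hz.smooth_symm hp hν.mdiff hνN hu hv
  rw [hB (F.coordVec_mem p _) (F.coordVec_mem p _), hB (F.coordVec_mem p _) (F.coordVec_mem p _),
    ← sum_bilin_of_coordinates hE haa hbb hab B]
  exact Finset.sum_congr rfl fun i _ => hB (Subtype.mem _) (Subtype.mem _)

/-- Since e₁ and e₂ commute, the normal part of T(e₁, e₂) = ∇_{e₁} e₂ - ∇_{e₂} e₁ is II(e₁, e₂) -
II(e₂, e₁): ⋆τ measures the asymmetry of II. -/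
theorem starTorsion_eq (hz : F.IsComplexChart o z) (hmetric : cov.IsMetricCompatible) {p : S}
    (hp : p ∈ z.source) : F.starTorsion cov o p =
      (F.secondFundamentalForm cov p (F.coordVec z p 1) (F.coordVec z p Complex.I) -
        F.secondFundamentalForm cov p (F.coordVec z p Complex.I) (F.coordVec z p 1)) /
        F.conformalFactor z p := by
  obtain ⟨ν, hν, hνN⟩ := hz.exists_normal_extension hp
  obtain ⟨e₁, e₂, h1, h2, h12, he⟩ := F.exists_adapted_fields hz.smooth hz.smooth_symm hp
  have hep := he.self_of_nhds
  obtain ⟨a, b, hE, haa, hbb, hab⟩ := exists_coordinates_of_conformal_basis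
    (hz.conformalFactor_pos hp).ne' (F.coordVec_mem p 1) (F.coordVec_mem p Complex.I)
    (fun v hv => F.exists_eq_of_mem_tangentPlane hz.smooth hz.smooth_symm hp hv) rfl
    (hz.inner_coordVec_I hp) (hz.inner_coordVec hp) (stdOrthonormalBasis ℝ (F.tangentPlane p))
  have hII : ∀ {u v}, u ∈ F.tangentPlane p → v ∈ F.tangentPlane p →
      F.secondFundamentalForm cov p u v = - inner ℝ (cov ν (F.emb p) u) v := fun hu hv =>
    F.secondFundamentalForm_eq hmetric hz.smooth hz.smooth_symm hp hν.mdiff hνN hu hv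
  let B : TangentSpace (𝓡 3) (F.emb p) →ₗ[ℝ] TangentSpace (𝓡 3) (F.emb p) →ₗ[ℝ] ℝ :=
    LinearMap.mk₂ ℝ (fun u v => F.torsionForm cov p u v)
      (fun u v w => by simp [torsionForm, inner_add_right])
      (fun c u v => by simp [torsionForm, inner_smul_right])
      (fun u v w => by simp [torsionForm, inner_add_right])
      (fun c u v => by simp [torsionForm, inner_smul_right])
  have up1 : ∀ n u v w : TangentSpace (𝓡 3) (F.emb p),
      Function.update ![n, u, v] 1 w = ![n, w, v] := fun n u v w => by
    ext i : 1
    fin_cases i <;> rfl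
  have up2 : ∀ n u v w : TangentSpace (𝓡 3) (F.emb p),
      Function.update ![n, u, v] 2 w = ![n, u, w] := fun n u v w => by
    ext i : 1
    fin_cases i <;> rfl
  let C : TangentSpace (𝓡 3) (F.emb p) →ₗ[ℝ] TangentSpace (𝓡 3) (F.emb p) →ₗ[ℝ] ℝ :=
    LinearMap.mk₂ ℝ (fun u v => F.areaForm o p u v)
      (fun u v w => by
        simpa only [areaForm, up1] using
          (o.at_ (F.emb p)).volumeForm.map_update_add ![F.normal p, u, w] 1 u v)
      (fun c u v => by
        simpa only [areaForm, up1] using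
          (o.at_ (F.emb p)).volumeForm.map_update_smul ![F.normal p, u, v] 1 c u)
      (fun u v w => by
        simpa only [areaForm, up2] using
          (o.at_ (F.emb p)).volumeForm.map_update_add ![F.normal p, u, v] 2 v w)
      (fun c u v => by
        simpa only [areaForm, up2] using
          (o.at_ (F.emb p)).volumeForm.map_update_smul ![F.normal p, u, v] 2 c v)
  have hB : B.IsAlt := fun u => by simp [B, torsionForm]
  have hC : C.IsAlt := fun u => by
    simp only [C, LinearMap.mk₂_apply, areaForm]
    exact (o.at_ (F.emb p)).volumeForm.map_eq_zero_of_eq _ (i := 1) (j := 2) rfl (by decide)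
  have hsum := sum_alternating_of_coordinates hE haa hbb hab B C hB hC
  have hBC : F.starTorsion cov o p = (1 / 2) * ∑ i, ∑ j,
    B (stdOrthonormalBasis ℝ (F.tangentPlane p) i) (stdOrthonormalBasis ℝ (F.tangentPlane p) j) *
    C (stdOrthonormalBasis ℝ (F.tangentPlane p) i) (stdOrthonormalBasis ℝ (F.tangentPlane p) j) :=
    rfl
  have hC12 : C (F.coordVec z p 1) (F.coordVec z p Complex.I) = F.conformalFactor z p :=
    hz.areaForm_coordVec hp
  have htan1 : ∀ᶠ q in 𝓝 p, e₁ (F.emb q) ∈ F.tangentPlane q := he.mono fun q hq => by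
    rw [hq.1]; exact F.coordVec_mem q _
  have htan2 : ∀ᶠ q in 𝓝 p, e₂ (F.emb q) ∈ F.tangentPlane q := he.mono fun q hq => by
    rw [hq.2]; exact F.coordVec_mem q _
  have hB12 : B (F.coordVec z p 1) (F.coordVec z p Complex.I) =
      F.secondFundamentalForm cov p (F.coordVec z p 1) (F.coordVec z p Complex.I) -
        F.secondFundamentalForm cov p (F.coordVec z p Complex.I) (F.coordVec z p 1) := by
    have ht := cov.torsion_apply h1.mdiff h2.mdiff
    rw [h12.self_of_nhds, sub_zero, hep.1, hep.2] at ht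
    change inner ℝ (F.normal p) _ = _
    rw [ht, inner_sub_right, F.inner_normal_cov hmetric hz.smooth hz.smooth_symm hp hν.mdiff hνN
      h2.mdiff htan2 (F.coordVec_mem p _), F.inner_normal_cov hmetric hz.smooth hz.smooth_symm hp
      hν.mdiff hνN h1.mdiff htan1 (F.coordVec_mem p _), hep.1, hep.2,
      hII (F.coordVec_mem p _) (F.coordVec_mem p _), hII (F.coordVec_mem p _) (F.coordVec_mem p _)]
  rw [hBC, hsum, hC12, hB12]
  have := (hz.conformalFactor_pos hp).ne'
  field_simp

end IsComplexChart

end OrientedSurface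

end NormalExtension

/-! ### The Cauchy-Riemann equations and the Codazzi equations. -/

section CauchyRiemann

theorem differentiableAt_complex_iff_cauchyRiemann {u v : ℂ → ℝ} {w : ℂ}
    (hu : DifferentiableAt ℝ u w) (hv : DifferentiableAt ℝ v w) :
    DifferentiableAt ℂ (fun x => (u x : ℂ) + Complex.I * (v x : ℂ)) w ↔
      fderiv ℝ u w Complex.I = - fderiv ℝ v w 1 ∧ fderiv ℝ v w Complex.I = fderiv ℝ u w 1 := by
  have h : HasFDerivAt (fun x => (u x : ℂ) + Complex.I * (v x : ℂ))
      (Complex.ofRealCLM.comp (fderiv ℝ u w) +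
        Complex.I • Complex.ofRealCLM.comp (fderiv ℝ v w)) w :=
    (Complex.ofRealCLM.hasFDerivAt.comp w hu.hasFDerivAt).add
      ((Complex.ofRealCLM.hasFDerivAt.comp w hv.hasFDerivAt).const_mul Complex.I)
  rw [differentiableAt_complex_iff_differentiableAt_real, h.fderiv,
    and_iff_right h.differentiableAt, Complex.ext_iff]
  simp

/-- The Codazzi equations in conformal coordinates, with the metric `g (dx² + dy²)` and the second
fundamental form `(aᵢⱼ)`, make the Cauchy-Riemann equations of the complex mean curvature and of
the Hopf differential equivalent. -/
theorem cauchyRiemann_iff_of_codazzi {a₁₁ a₁₂ a₂₁ a₂₂ g : ℂ → ℝ} {w : ℂ}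
    (h11 : DifferentiableAt ℝ a₁₁ w) (h12 : DifferentiableAt ℝ a₁₂ w)
    (h21 : DifferentiableAt ℝ a₂₁ w) (h22 : DifferentiableAt ℝ a₂₂ w)
    (hg : DifferentiableAt ℝ g w) (hg0 : g w ≠ 0)
    (h1 : 2 * g w * (fderiv ℝ a₂₁ w 1 - fderiv ℝ a₁₁ w Complex.I) =
      (a₂₁ w - a₁₂ w) * fderiv ℝ g w 1 - (a₁₁ w + a₂₂ w) * fderiv ℝ g w Complex.I)
    (h2 : 2 * g w * (fderiv ℝ a₂₂ w 1 - fderiv ℝ a₁₂ w Complex.I) =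
      (a₂₁ w - a₁₂ w) * fderiv ℝ g w Complex.I + (a₁₁ w + a₂₂ w) * fderiv ℝ g w 1) :
    DifferentiableAt ℂ (fun x => (((a₁₁ x + a₂₂ x) / g x : ℝ) : ℂ) +
        Complex.I * (((a₁₂ x - a₂₁ x) / g x : ℝ) : ℂ)) w ↔
      DifferentiableAt ℂ (fun x => (1 / 4 : ℂ) * ((a₁₁ x : ℂ) - Complex.I * (a₁₂ x : ℂ) -
        Complex.I * (a₂₁ x : ℂ) - (a₂₂ x : ℂ))) w := by
  have hφ : (fun x => (1 / 4 : ℂ) * ((a₁₁ x : ℂ) - Complex.I * (a₁₂ x : ℂ) -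
      Complex.I * (a₂₁ x : ℂ) - (a₂₂ x : ℂ))) = fun x =>
        (((1 / 4) * (a₁₁ x - a₂₂ x) : ℝ) : ℂ) +
          Complex.I * (((-1 / 4) * (a₁₂ x + a₂₁ x) : ℝ) : ℂ) := by
    funext x
    push_cast
    ring
  have hdiv : ∀ {f : ℂ → ℝ}, DifferentiableAt ℝ f w → HasFDerivAt (fun x => f x / g x)
      (((g w) ^ 2)⁻¹ • (g w • fderiv ℝ f w - f w • fderiv ℝ g w)) w := by
    intro f hf
    simp only [div_eq_mul_inv]
    refine HasFDerivAt.congr_fderiv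
      (hf.hasFDerivAt.fun_mul ((hasDerivAt_inv hg0).comp_hasFDerivAt w hg.hasFDerivAt)) ?_
    ext c
    simp
    field_simp
    ring
  have hH := hdiv (h11.fun_add h22)
  have hs := hdiv (h12.fun_sub h21)
  rw [hφ, differentiableAt_complex_iff_cauchyRiemann hH.differentiableAt hs.differentiableAt,
    differentiableAt_complex_iff_cauchyRiemann
    ((h11.fun_sub h22).const_mul _) ((h12.fun_add h21).const_mul _), hH.fderiv, hs.fderiv,
    fderiv_const_mul (h11.fun_sub h22), fderiv_const_mul (h12.fun_add h21),
    fderiv_fun_add h11 h22, fderiv_fun_sub h12 h21, fderiv_fun_sub h11 h22, fderiv_fun_add h12 h21]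
  have hg2 : ((g w) ^ 2)⁻¹ ≠ 0 := inv_ne_zero (pow_ne_zero 2 hg0)
  simp only [add_apply, sub_apply,
    smul_apply, smul_eq_mul]
  rw [← mul_neg, mul_right_inj' hg2, mul_right_inj' hg2]
  -- The Codazzi equations are the imaginary and real parts of ∂φ/∂z̄ = (g / 4) · conj(∂𝐇/∂z̄), so
  -- the two Cauchy-Riemann equations correspond one by one.
  refine and_congr ⟨fun h => ?_, fun h => ?_⟩ ⟨fun h => ?_, fun h => ?_⟩
  · apply mul_left_cancel₀ hg0
    linear_combination (-1 / 4 : ℝ) * h - (1 / 4 : ℝ) * h1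
  · linear_combination (-4 * g w) * h - h1
  · apply mul_left_cancel₀ hg0
    linear_combination (1 / 4 : ℝ) * h + (1 / 4 : ℝ) * h2
  · linear_combination (4 * g w) * h - h2

end CauchyRiemann

/-! ### The Codazzi equations for a metric connection with torsion. -/

section Codazzi

open VectorField

variable {M : Type*} [TopologicalSpace M] [T2Space M] [ChartedSpace E3 M] [IsManifold (𝓡 3) ∞ M]
  [RiemannianBundle (fun x : M => TangentSpace (𝓡 3) x)]
  [IsContMDiffRiemannianBundle (𝓡 3) ∞ E3 (fun x : M => TangentSpace (𝓡 3) x)]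
  {cov : CovariantDerivative (𝓡 3) E3 (fun x : M => TangentSpace (𝓡 3) x)}
  [cov.ContMDiffCovariantDerivative ∞]
  {x : M} {e₁ e₂ ν : Π x : M, TangentSpace (𝓡 3) x}

/-- The Codazzi equations, for commuting fields `e₁`, `e₂` that are conformal along a surface with
normal field `ν`. -/
theorem codazzi_of_conformal (hmetric : cov.IsMetricCompatible)
    (h1 : SmoothFieldNear e₁ x) (h2 : SmoothFieldNear e₂ x) (hν : SmoothFieldNear ν x)
    (hbr : mlieBracket (𝓡 3) e₁ e₂ x = 0)
    (h22 : inner ℝ (e₂ x) (e₂ x) = inner ℝ (e₁ x) (e₁ x)) (h12 : inner ℝ (e₁ x) (e₂ x) = 0)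
    (hspan : ∀ w : TangentSpace (𝓡 3) x, inner ℝ w (ν x) = 0 → inner ℝ w (e₁ x) = 0 →
      inner ℝ w (e₂ x) = 0 → w = 0)
    (hν1 : inner ℝ (cov ν x (e₁ x)) (ν x) = 0) (hν2 : inner ℝ (cov ν x (e₂ x)) (ν x) = 0)
    (hνe1 : inner ℝ (e₁ x) (ν x) = 0) (hνe2 : inner ℝ (e₂ x) (ν x) = 0)
    (hR1 : inner ℝ (curvatureAt cov x (e₁ x) (e₂ x) (ν x)) (e₁ x) = 0)
    (hR2 : inner ℝ (curvatureAt cov x (e₁ x) (e₂ x) (ν x)) (e₂ x) = 0)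
    (hT1 : inner ℝ (cov.torsion x (e₁ x) (e₂ x)) (e₁ x) = 0)
    (hT2 : inner ℝ (cov.torsion x (e₁ x) (e₂ x)) (e₂ x) = 0)
    (hd12 : ∀ v ∈ ({e₁ x, e₂ x} : Set (TangentSpace (𝓡 3) x)),
      mvfderiv (𝓡 3) (fun y => inner ℝ (e₁ y) (e₂ y)) x v = 0)
    (hd22 : ∀ v ∈ ({e₁ x, e₂ x} : Set (TangentSpace (𝓡 3) x)),
      mvfderiv (𝓡 3) (fun y => inner ℝ (e₂ y) (e₂ y)) x v =
        mvfderiv (𝓡 3) (fun y => inner ℝ (e₁ y) (e₁ y)) x v) :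
    2 * inner ℝ (e₁ x) (e₁ x) *
        (mvfderiv (𝓡 3) (fun y => inner ℝ (cov ν y (e₂ y)) (e₁ y)) x (e₁ x) -
          mvfderiv (𝓡 3) (fun y => inner ℝ (cov ν y (e₁ y)) (e₁ y)) x (e₂ x)) =
      (inner ℝ (cov ν x (e₂ x)) (e₁ x) - inner ℝ (cov ν x (e₁ x)) (e₂ x)) *
          mvfderiv (𝓡 3) (fun y => inner ℝ (e₁ y) (e₁ y)) x (e₁ x) -
        (inner ℝ (cov ν x (e₁ x)) (e₁ x) + inner ℝ (cov ν x (e₂ x)) (e₂ x)) *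
          mvfderiv (𝓡 3) (fun y => inner ℝ (e₁ y) (e₁ y)) x (e₂ x) ∧
    2 * inner ℝ (e₁ x) (e₁ x) *
        (mvfderiv (𝓡 3) (fun y => inner ℝ (cov ν y (e₂ y)) (e₂ y)) x (e₁ x) -
          mvfderiv (𝓡 3) (fun y => inner ℝ (cov ν y (e₁ y)) (e₂ y)) x (e₂ x)) =
      (inner ℝ (cov ν x (e₂ x)) (e₁ x) - inner ℝ (cov ν x (e₁ x)) (e₂ x)) *
          mvfderiv (𝓡 3) (fun y => inner ℝ (e₁ y) (e₁ y)) x (e₂ x) +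
        (inner ℝ (cov ν x (e₁ x)) (e₁ x) + inner ℝ (cov ν x (e₂ x)) (e₂ x)) *
          mvfderiv (𝓡 3) (fun y => inner ℝ (e₁ y) (e₁ y)) x (e₁ x) := by
  -- A vector ∇_u ν orthogonal to ν is expanded in the orthogonal basis e₁, e₂; multiplying by g =
  -- |e₁|² avoids division.
  have hP : ∀ u : TangentSpace (𝓡 3) x, inner ℝ (cov ν x u) (ν x) = 0 →
      ∀ w, inner ℝ (e₁ x) (e₁ x) * inner ℝ (cov ν x u) w =
        inner ℝ (cov ν x u) (e₁ x) * inner ℝ w (e₁ x) +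
          inner ℝ (cov ν x u) (e₂ x) * inner ℝ w (e₂ x) := by
    intro u hu w
    have key : inner ℝ (e₁ x) (e₁ x) • cov ν x u - inner ℝ (cov ν x u) (e₁ x) • e₁ x -
        inner ℝ (cov ν x u) (e₂ x) • e₂ x = 0 := by
      apply hspan <;> simp only [inner_sub_left, real_inner_smul_left, hu, hνe1, hνe2, h12, h22,
        real_inner_comm (e₁ x) (e₂ x)] <;> ring
    have := congrArg (fun v => inner ℝ w v) key
    simp only [inner_sub_right, real_inner_smul_right, inner_zero_right] at this
    rw [real_inner_comm (cov ν x u) w] at this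
    linarith
  have hc1 := hν.covDeriv cov h1
  have hc2 := hν.covDeriv cov h2
  have hR := curvatureField_eq_curvatureAt cov h1 h2 hν
  rw [curvatureField, hbr, map_zero, sub_zero] at hR
  rw [← hR, inner_sub_left] at hR1 hR2
  have hT := cov.torsion_apply h1.mdiff h2.mdiff
  rw [hbr, sub_zero] at hT
  rw [hT, inner_sub_left] at hT1 hT2
  have d11 := hd12 (e₁ x) (by simp)
  have d12 := hd12 (e₂ x) (by simp)
  have d21 := hd22 (e₁ x) (by simp)
  have d22 := hd22 (e₂ x) (by simp)
  rw [mvfderiv_inner_of_smoothFieldNear hmetric h1 h2] at d11 d12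
  rw [mvfderiv_inner_of_smoothFieldNear hmetric h1 h1,
    mvfderiv_inner_of_smoothFieldNear hmetric h2 h2] at d21 d22
  rw [mvfderiv_inner_of_smoothFieldNear hmetric h1 h1,
    mvfderiv_inner_of_smoothFieldNear hmetric h1 h1,
    mvfderiv_inner_of_smoothFieldNear hmetric hc2 h1,
    mvfderiv_inner_of_smoothFieldNear hmetric hc1 h1,
    mvfderiv_inner_of_smoothFieldNear hmetric hc2 h2,
    mvfderiv_inner_of_smoothFieldNear hmetric hc1 h2]
  -- Differentiating ⟨∇_{eⱼ} ν, eₖ⟩ leaves terms ⟨∇_{eⱼ} ν, ∇_{eᵢ} eₖ⟩, and `hP` reduces them to the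
  -- tangential components of ∇_{eᵢ} eₖ. Conformality and the vanishing tangential torsion express
  -- those as ± half derivatives of g.
  have p1 := hP _ hν1
  have p2 := hP _ hν2
  have q21 := p2 (cov e₁ x (e₁ x))
  have q11 := p1 (cov e₁ x (e₂ x))
  have q22 := p2 (cov e₂ x (e₁ x))
  have q12 := p1 (cov e₂ x (e₂ x))
  simp only [real_inner_comm (cov e₁ x _) (e₁ x), real_inner_comm (cov e₂ x _) (e₁ x),
    real_inner_comm (cov e₂ x _) (e₂ x)] at *
  constructor
  · linear_combination 2 * inner ℝ (e₁ x) (e₁ x) * hR1 + 2 * q21 - 2 * q11 +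
      2 * inner ℝ (cov ν x (e₂ x)) (e₂ x) * (d11 - hT1) -
      2 * inner ℝ (cov ν x (e₁ x)) (e₂ x) * (d21 / 2 - hT2)
  · linear_combination 2 * inner ℝ (e₁ x) (e₁ x) * hR2 + 2 * q22 - 2 * q12 +
      2 * inner ℝ (cov ν x (e₂ x)) (e₁ x) * hT1 +
      inner ℝ (cov ν x (e₂ x)) (e₂ x) * d21 -
      2 * inner ℝ (cov ν x (e₁ x)) (e₁ x) * (d12 + hT2 - d21 / 2) -
      inner ℝ (cov ν x (e₁ x)) (e₂ x) * d22

end Codazzi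

/-! ### Equivalence of the two holomorphy conditions. -/

section Hopf

open VectorField

variable {M : Type*} [TopologicalSpace M] [T2Space M] [ChartedSpace E3 M] [IsManifold (𝓡 3) ∞ M]
  [RiemannianBundle (fun x : M => TangentSpace (𝓡 3) x)]
  [IsContMDiffRiemannianBundle (𝓡 3) ∞ E3 (fun x : M => TangentSpace (𝓡 3) x)]
  {cov : CovariantDerivative (𝓡 3) E3 (fun x : M => TangentSpace (𝓡 3) x)}
  [cov.ContMDiffCovariantDerivative ∞]
  {S : Type*} [TopologicalSpace S] [ChartedSpace E2 S] [IsManifold (𝓡 2) ∞ S]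
  {F : OrientedSurface M S} {z : OpenPartialHomeomorph S ℂ} {o : ManifoldOrientation M}

namespace OrientedSurface.IsComplexChart

/-- The common core of both parts of the theorem: `hR` and `hT` are all that is used of the ambient
geometry besides metric compatibility. -/
theorem differentiableAt_complexMeanCurvature_iff (hz : F.IsComplexChart o z)
    (hmetric : cov.IsMetricCompatible) {p : S} (hp : p ∈ z.source)
    (hR : ∀ u v n : TangentSpace (𝓡 3) (F.emb p), u ≠ 0 → v ≠ 0 → n ≠ 0 → inner ℝ u v = 0 →
      inner ℝ u n = 0 → inner ℝ v n = 0 → inner ℝ (curvatureAt cov (F.emb p) u v n) u = 0)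
    (hT : ∀ u v : TangentSpace (𝓡 3) (F.emb p), inner ℝ (cov.torsion (F.emb p) u v) u = 0) :
    DifferentiableAt ℂ (F.complexMeanCurvature cov o ∘ z.symm) (z p) ↔
      DifferentiableAt ℂ (F.hopfCoeff cov z ∘ z.symm) (z p) := by
  obtain ⟨ν, hν, hνN⟩ := hz.exists_normal_extension hp
  obtain ⟨e₁, e₂, h1, h2, h12, he⟩ := F.exists_adapted_fields hz.smooth hz.smooth_symm hp
  have hep := he.self_of_nhds
  have hνp := hνN.self_of_nhds
  have hn1 : inner ℝ (F.coordVec z p 1) (F.normal p) = 0 := by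
    rw [real_inner_comm, F.inner_normal_of_mem (F.coordVec_mem p _)]
  have hn2 : inner ℝ (F.coordVec z p Complex.I) (F.normal p) = 0 := by
    rw [real_inner_comm, F.inner_normal_of_mem (F.coordVec_mem p _)]
  have h21 : inner ℝ (F.coordVec z p Complex.I) (F.coordVec z p 1) = 0 := by
    rw [real_inner_comm, hz.inner_coordVec hp]
  have hsymm := hz.smooth_symm
  have hνν : ∀ a : ℂ, inner ℝ (cov ν (F.emb p) (F.coordVec z p a)) (ν (F.emb p)) = 0 := by
    intro a
    have h := F.mvfderiv_coordVec_eq_zero hsymm hp (hν.inner hν).mdiff (c := 1)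
      (hνN.mono fun q hq => by rw [hq, real_inner_self_eq_norm_sq, F.norm_normal, one_pow]) a
    rw [mvfderiv_inner_of_smoothFieldNear hmetric hν hν,
      real_inner_comm (cov ν (F.emb p) (F.coordVec z p a)) (ν (F.emb p))] at h
    linarith
  have hT' : ∀ u v : TangentSpace (𝓡 3) (F.emb p),
      inner ℝ (cov.torsion (F.emb p) u v) v = 0 := by
    intro u v
    rw [cov.torsion_antisymm, inner_neg_left, hT, neg_zero]
  have hsource : ∀ᶠ q in 𝓝 p, q ∈ z.source := z.open_source.mem_nhds hp
  obtain ⟨C1, C2⟩ := codazzi_of_conformal hmetric h1 h2 hν h12.self_of_nhds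
    (by rw [hep.1, hep.2, hz.inner_coordVec_I hp, conformalFactor])
    (by rw [hep.1, hep.2, hz.inner_coordVec hp])
    (fun w a b c => hz.eq_zero_of_inner hp (by rwa [hνp] at a) (by rwa [hep.1] at b)
      (by rwa [hep.2] at c))
    (by rw [hep.1]; exact hνν 1) (by rw [hep.2]; exact hνν Complex.I)
    (by rw [hep.1, hνp, hn1]) (by rw [hep.2, hνp, hn2])
    (by
      rw [hep.1, hep.2, hνp]
      exact hR _ _ _ (hz.coordVec_one_ne_zero hp) (hz.coordVec_I_ne_zero hp) (F.normal_ne_zero p)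
        (hz.inner_coordVec hp) hn1 hn2)
    (by
      rw [hep.1, hep.2, hνp, curvatureAt_swap, inner_neg_left, hR _ _ _ (hz.coordVec_I_ne_zero hp)
        (hz.coordVec_one_ne_zero hp) (F.normal_ne_zero p) h21 hn2 hn1, neg_zero])
    (hT _ _) (hT' _ _)
    (by
      intro v hv
      have key := fun a => F.mvfderiv_coordVec_eq_zero hsymm hp (h1.inner h2).mdiff (c := 0)
        ((he.and hsource).mono fun q hq => by
          rw [hq.1.1, hq.1.2, hz.inner_coordVec hq.2]) a
      rcases hv with rfl | rfl
      · rw [hep.1, key]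
      · rw [hep.2, key])
    (by
      intro v hv
      have key := fun a => F.mvfderiv_coordVec_eq hsymm hp (h2.inner h2).mdiff (h1.inner h1).mdiff
        ((he.and hsource).mono fun q hq => by
          rw [hq.1.1, hq.1.2, hz.inner_coordVec_I hq.2, conformalFactor]) a
      rcases hv with rfl | rfl
      · rw [hep.1, key]
      · rw [hep.2, key])
  have m11 := ((hν.covDeriv cov h1).inner h1).mdiff
  have m12 := ((hν.covDeriv cov h1).inner h2).mdiff
  have m21 := ((hν.covDeriv cov h2).inner h1).mdiff
  have m22 := ((hν.covDeriv cov h2).inner h2).mdiff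
  have mg := (h1.inner h1).mdiff
  have hII : ∀ᶠ q in 𝓝 p, ∀ a b : ℂ,
      F.secondFundamentalForm cov q (F.coordVec z q a) (F.coordVec z q b) =
        - inner ℝ (cov ν (F.emb q) (F.coordVec z q a)) (F.coordVec z q b) := by
    filter_upwards [hsource, F.eventually_emb hν.eventually, eventually_eventually_nhds.2 hνN] with
      q hq hνq hNq a b
    exact F.secondFundamentalForm_eq hmetric hz.smooth hsymm hq hνq.mdiff hNq
      (F.coordVec_mem q _) (F.coordVec_mem q _)
  have hval : ∀ k : M → ℝ, (k ∘ F.emb ∘ z.symm) (z p) = k (F.emb p) := fun k =>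
    congrArg (k ∘ F.emb) (z.left_inv hp)
  have main := cauchyRiemann_iff_of_codazzi
    (F.differentiableAt_comp_emb_symm hsymm hp m11) (F.differentiableAt_comp_emb_symm hsymm hp m12)
    (F.differentiableAt_comp_emb_symm hsymm hp m21) (F.differentiableAt_comp_emb_symm hsymm hp m22)
    (F.differentiableAt_comp_emb_symm hsymm hp mg)
    (by
      rw [hval, hep.1]
      exact (hz.conformalFactor_pos hp).ne')
    (by
      simp only [F.fderiv_comp_emb_symm hsymm hp, m11, m21, mg, hval]
      rw [← hep.1, ← hep.2]
      exact C1)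
    (by
      simp only [F.fderiv_comp_emb_symm hsymm hp, m12, m22, mg, hval]
      rw [← hep.1, ← hep.2]
      exact C2)
  -- The functions in `main` are built from ⟨∇_{eᵢ} ν, eⱼ⟩ = -II(eᵢ, eⱼ), so they are -𝐇 and minus
  -- the Hopf coefficient.
  rw [← differentiableAt_fun_neg_iff, ← differentiableAt_fun_neg_iff (𝕜 := ℂ)
    (f := fun x => (1 / 4 : ℂ) * _)] at main
  refine Iff.trans (Filter.EventuallyEq.differentiableAt_iff ?_)
    (main.trans (Filter.EventuallyEq.differentiableAt_iff ?_).symm)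
  · filter_upwards [eventually_comp_symm hp hII, eventually_comp_symm hp he,
      eventually_comp_symm hp hsource] with w hIIw hew hw
    simp only [Function.comp_apply, complexMeanCurvature, hz.meanCurvature_eq hmetric hw,
      hz.starTorsion_eq hmetric hw, hIIw, hew.1, hew.2, conformalFactor]
    push_cast
    ring
  · filter_upwards [eventually_comp_symm hp hII, eventually_comp_symm hp he] with w hIIw hew
    simp only [Function.comp_apply, hopfCoeff, hIIw, hew.1, hew.2]
    push_cast
    ring

theorem differentiableOn_complexMeanCurvature_iff (hz : F.IsComplexChart o z)
    (hmetric : cov.IsMetricCompatible)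
    (hR : ∀ (x : M) (u v n : TangentSpace (𝓡 3) x), u ≠ 0 → v ≠ 0 → n ≠ 0 → inner ℝ u v = 0 →
      inner ℝ u n = 0 → inner ℝ v n = 0 → inner ℝ (curvatureAt cov x u v n) u = 0)
    (hT : ∀ (x : M) (u v : TangentSpace (𝓡 3) x), inner ℝ (cov.torsion x u v) u = 0) :
    DifferentiableOn ℂ (F.complexMeanCurvature cov o ∘ z.symm) z.target ↔
      DifferentiableOn ℂ (F.hopfCoeff cov z ∘ z.symm) z.target := by
  have key : ∀ f : ℂ → ℂ, DifferentiableOn ℂ f z.target ↔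
      ∀ p ∈ z.source, DifferentiableAt ℂ f (z p) := fun f =>
    ⟨fun h p hp => (h _ (z.map_source hp)).differentiableAt
      (z.open_target.mem_nhds (z.map_source hp)), fun h w hw => by
        have := h _ (z.map_target hw)
        rw [z.right_inv hw] at this
        exact this.differentiableWithinAt⟩
  rw [key, key]
  exact forall₂_congr fun p hp => hz.differentiableAt_complexMeanCurvature_iff hmetric hp
    (hR _) (hT _)

end OrientedSurface.IsComplexChart

/-- A real function which is holomorphic in a chart is locally constant on its domain. -/
theorem differentiableOn_ofReal_comp_symm_iff {h : S → ℝ} :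
    DifferentiableOn ℂ ((fun q => (h q : ℂ)) ∘ z.symm) z.target ↔
      ∀ p ∈ z.source, ∀ᶠ q in 𝓝 p, h q = h p := by
  constructor
  · intro H p hp
    obtain ⟨r, hr, hball⟩ := Metric.isOpen_iff.1 z.open_target (z p) (z.map_source hp)
    have hu : ∀ w ∈ Metric.ball (z p) r, DifferentiableAt ℝ (h ∘ z.symm) w ∧
        fderiv ℝ (h ∘ z.symm) w = 0 := by
      intro w hw
      have hd : DifferentiableAt ℂ ((fun q => (h q : ℂ)) ∘ z.symm) w :=
        (H w (hball hw)).differentiableAt (z.open_target.mem_nhds (hball hw))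
      have hd' : DifferentiableAt ℝ (h ∘ z.symm) w :=
        Complex.reCLM.differentiableAt.comp w (hd.restrictScalars ℝ)
      -- With imaginary part 0, the Cauchy-Riemann equations annihilate both partial derivatives of
      -- the real part.
      have hd0 : DifferentiableAt ℂ (fun x => (((h ∘ z.symm) x : ℝ) : ℂ) +
          Complex.I * (((fun _ => 0) x : ℝ) : ℂ)) w := by
        simpa [Function.comp_def] using hd
      obtain ⟨e1, e2⟩ :=
        (differentiableAt_complex_iff_cauchyRiemann hd' (differentiableAt_const 0)).1 hd0
      refine ⟨hd', ?_⟩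
      ext a
      have ha : a = a.re • (1 : ℂ) + a.im • Complex.I := by
        apply Complex.ext <;> simp
      rw [ha, map_add, map_smul, map_smul, e1, ← e2]
      simp
    have hconst : ∀ w ∈ Metric.ball (z p) r, (h ∘ z.symm) w = (h ∘ z.symm) (z p) := fun w hw =>
      Metric.isOpen_ball.is_const_of_fderiv_eq_zero (convex_ball _ _).isPreconnected
        (fun v hv => (hu v hv).1.differentiableWithinAt) (fun v hv => (hu v hv).2) hw
        (Metric.mem_ball_self hr)
    filter_upwards [z.open_source.mem_nhds hp,
      (z.continuousAt hp).eventually (Metric.ball_mem_nhds _ hr)] with q hq hqb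
    have := hconst _ hqb
    rwa [Function.comp_apply, Function.comp_apply, z.left_inv hq, z.left_inv hp] at this
  · intro H w hw
    have := OrientedSurface.eventually_comp_symm (z.map_target hw) (H _ (z.map_target hw))
    rw [z.right_inv hw] at this
    refine DifferentiableAt.differentiableWithinAt ?_
    refine (differentiableAt_const (h (z.symm w) : ℂ)).congr_of_eventuallyEq ?_
    filter_upwards [this] with v hv
    simp [hv]

end Hopf

end

theorem mainTheorem10 {M : Type*} [TopologicalSpace M] [T2Space M] [SecondCountableTopology M]
    [ChartedSpace E3 M] [IsManifold (𝓡 3) ∞ M]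
    [RiemannianBundle (fun x : M => TangentSpace (𝓡 3) x)]
    [IsContMDiffRiemannianBundle (𝓡 3) ∞ E3 (fun x : M => TangentSpace (𝓡 3) x)]
    (o : ManifoldOrientation M)
    (cov : CovariantDerivative (𝓡 3) E3 (fun x : M => TangentSpace (𝓡 3) x))
    [cov.ContMDiffCovariantDerivative ∞]
    (hmetric : cov.IsMetricCompatible) :
    ((∀ x : M, ∃ r : ℝ, ∀ u v : TangentSpace (𝓡 3) x, ricci cov x u v = r * inner ℝ u v) →
      (∀ x : M, ∃ t : ℝ, ∀ u v : TangentSpace (𝓡 3) x,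
        cov.torsion x u v = t • crossProd (o.at_ x) u v) →
      ∀ {S : Type*} [TopologicalSpace S] [ChartedSpace E2 S] [IsManifold (𝓡 2) ∞ S]
        (F : OrientedSurface M S),
        F.IsHolomorphic o (F.complexMeanCurvature cov o) ↔ F.HopfDifferentialIsHolomorphic cov o) ∧
    (cov.torsion = 0 →
      (∃ κ : ℝ, ∀ (x : M) (u v : TangentSpace (𝓡 3) x), LinearIndependent ℝ ![u, v] →
        sectionalCurvature cov x u v = κ) →
      ∀ {S : Type*} [TopologicalSpace S] [ChartedSpace E2 S] [IsManifold (𝓡 2) ∞ S]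
        (F : OrientedSurface M S),
        (∀ p, F.complexMeanCurvature cov o p = F.meanCurvature cov p) ∧
        ((∀ z : OpenPartialHomeomorph S ℂ, F.IsComplexChart o z →
            ∀ p ∈ z.source, ∀ᶠ q in 𝓝 p, F.meanCurvature cov q = F.meanCurvature cov p) ↔
          F.HopfDifferentialIsHolomorphic cov o)) := by
  constructor
  · intro hric htor S _ _ _ F
    refine forall₂_congr fun z hz => hz.differentiableOn_complexMeanCurvature_iff hmetric ?_ ?_
    · intro x u v n hu hv hn huv hun hvn
      obtain ⟨r, hr⟩ := hric x
      exact inner_curvatureAt_of_ricci hmetric hr hu hv hn huv hun hvn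
    · intro x u v
      obtain ⟨t, ht⟩ := htor x
      -- ⟨u × v, u⟩ = vol(u, v, u) has a repeated argument, so the torsion of tangent vectors is
      -- normal to the surface.
      rw [ht, inner_smul_left, inner_crossProd,
        (o.at_ x).volumeForm.map_eq_zero_of_eq _ (i := 0) (j := 2) rfl (by decide), mul_zero]
  · rintro htor ⟨κ, hκ⟩ S _ _ _ F
    have hreal : F.complexMeanCurvature cov o = fun p => (F.meanCurvature cov p : ℂ) := by
      funext p
      simp [OrientedSurface.complexMeanCurvature, OrientedSurface.starTorsion,
        OrientedSurface.torsionForm, htor]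
    refine ⟨fun p => congrFun hreal p, forall₂_congr fun z hz => ?_⟩
    -- Local constancy of H in a chart is holomorphy of 𝐇 = H there, which brings this case under
    -- the same equivalence as the first part.
    rw [← differentiableOn_ofReal_comp_symm_iff, ← hreal]
    refine hz.differentiableOn_complexMeanCurvature_iff hmetric ?_ ?_
    · intro x u v n hu hv hn huv hun hvn
      exact inner_curvatureAt_of_sectionalCurvature hmetric htor (hκ x) hu hv hn huv hun hvn
    · intro x u v
      simp [htor]
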